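/- For nonnegative integers $m,n$ let $G_{m,n}=\{0,\infty\}\cup\{p/q : 1\le p\le m,\ 1\le q\le n\}$, and let $\mathcal G_{m,n}$ be the set of all $((a,b),(m,n))$ such that $a<b$ are adjacent elements of $G_{m,n}$. Put $\check{\mathcal G}_k=\bigsqcup_{m+n=k}\mathcal G_{m,n}$. For $k\ge 1$ define $\check V_k:\check{\mathcal G}_k\to\check{\mathcal G}_{k-1}$ by $$((0,\infty),(0,n))\mapsto((0,\infty),(0,n-1)),\qquad ((0,\infty),(m,0))\mapsto((0,\infty),(m-1,0)),$$ and, for $m,n\ge1$, $$((a,b),(m,n))\mapsto\begin{cases}((a,b),(m-1,n)) & (b<m/n),\\ ((a,\min\{c\in G_{m-1,n}:a<c\}),(m-1,n)) & (b=m/n),\\ ((\max\{c\in G_{m,n-1}:c<b\},b),(m,n-1)) & (a=m/n),\\ ((a,b),(m,n-1)) & (a>m/n).\end{cases}$$ For positive integers $m,n$ let $\mathcal T_{m,n}$ be the set of all $(f(m,1),f(1,n),(m,n))$, where $f:([m]\times\{1\})\cup(\{1\}\times[n])\to[mn]$ (with $[m]=\{1,\dots,m\}$) is an injection such that $f(1,1)=1$,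 $f(i+1,1)-f(i,1)=\#\{t\in[n]:f(1,t)\le f(i+1,1)\}$ for $i\in[m-1]$, and $f(1,j+1)-f(1,j)=\#\{s\in[m]:f(s,1)\le f(1,j+1)\}$ for $j\in[n-1]$. Put $\check{\mathcal T}_{k}=\bigsqcup_{m,n\ge1,\,m+n=k}\mathcal T_{m,n}$ for $k\ge2$, and for $k\ge3$ define $\check u_k:\check{\mathcal T}_k\to\check{\mathcal T}_{k-1}$ by $(s,t,(m,n))\mapsto(s-n,t,(m-1,n))$ if $s>t$ and $(s,t,(m,n))\mapsto(s,t-m,(m,n-1))$ if $s<t$. For positive integers $m,n$ and real $\xi>0$ let $\tau^{m,n}_\xi(i,j)=\#\{(s,t)\in[m]\times[n]:s+t\xi\le i+j\xi\}$. Let $\check{TY}_k$ ($k\ge2$) be the set of all $(\tau^{m,n}_\xi(m,1),\tau^{m,n}_\xi(1,n),(m,n))$ with $m,n\ge1$, $m+n=k$, and $\xi>0$ such that $\tau^{m,n}_\xi$ is injective on $[m]\times[n]$. For $k\ge 0$ define $\check{ST}_{k+1}$ on $\check{\mathcal G}_k$ by $$\check{ST}_{k+1}((a,b),(m,n))=(\tau^{m+1,n+1}_\xi(m+1,1),\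 \tau^{m+1,n+1}_\xi(1,n+1),\ (m+1,n+1)),$$ where $\xi\in(a,b)$ is an arbitrary real number. For an integer $N\ge0$ let $\mathbb T^{\check{\mathcal G},\check V}_N$ be the rooted tree whose level $k$ vertices ($0\le k\le N$) are the elements of $\check{\mathcal G}_k$, whose root is $((0,\infty),(0,0))$, and in which the parent of a vertex $v$ of level $k\ge1$ is $\check V_k(v)$. Let $\mathbb T^{\check{\mathcal T},\check u}_N$ be the rooted tree whose level $k$ vertices ($0\le k\le N$) are the elements of $\check{\mathcal T}_{k+2}$, whose root is $(1,1,(1,1))$, and in which the parent of a vertex $v$ of level $k\ge1$ is $\check u_{k+2}(v)$. Then, for every integer $N\ge0$: (a) Both graphs are trees, their level $0$ consists of the root only, and the maps $\check V_{k+1}:\check{\mathcal G}_{k+1}\to\check{\mathcal G}_k$ and $\check u_{k+3}:\check{\mathcal T}_{k+3}\to\check{\mathcal T}_{k+2}$ ($0\le k<N$) are well defined and surjective. (b) $\mathbb T^{\check{\mathcal T},\check u}_N$ is generated from its root $(1,1,(1,1))$ by the following rule: for $0\le k<N$, the children of a level $k$ vertex $(s,t,(m,n))$ are $(s+n,t,(m+1,n))$,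 which is present if and only if $s-t>-n$, and $(s,t+m,(m,n+1))$, which is present if and only if $s-t<m$; and the vertices of level $k+1$ are exactly the children of the vertices of level $k$. (c) For $0\le k\le N$ the value of $\check{ST}_{k+1}$ does not depend on the choice of $\xi\in(a,b)$, the map $\check{ST}_{k+1}:\check{\mathcal G}_k\to\check{TY}_{k+2}$ is a bijection, and $\check{TY}_{k+2}=\check{\mathcal T}_{k+2}$. (d) The rooted trees $\mathbb T^{\check{\mathcal G},\check V}_N$ and $\mathbb T^{\check{\mathcal T},\check u}_N$ are isomorphic, by the isomorphism that is given on the level $k$ vertices by $\check{ST}_{k+1}$, $k=0,1,\dots,N$. -/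

import Mathlib

namespace FareyTree

/-! ## Generalized Farey intervals -/

/-- The generalized Farey fractions `{0, ∞} ∪ {p / q : 1 ≤ p ≤ m, 1 ≤ q ≤ n}`, as a subset of the
extended reals (`⊤` is `∞`). It is `{0, ∞}` when `m * n = 0`. -/
def fractions (m n : ℕ) : Set EReal :=
  {0, ⊤} ∪ {x | ∃ p ∈ Finset.Icc 1 m, ∃ q ∈ Finset.Icc 1 n, x = (((p : ℝ) / (q : ℝ) : ℝ) : EReal)}

/-- `(a, b)` is an open interval formed by two successive generalized Farey fractions. -/
def IsInterval (m n : ℕ) (a b : EReal) : Prop :=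
  a ∈ fractions m n ∧ b ∈ fractions m n ∧ a < b ∧ ∀ c ∈ fractions m n, ¬ (a < c ∧ c < b)

/-- An interval, given by its two end points, tagged with a double index. -/
abbrev TaggedInterval : Type := (EReal × EReal) × (ℕ × ℕ)

/-- The intervals of index `(m, n)`, tagged with `(m, n)`. -/
def taggedIntervals (m n : ℕ) : Set TaggedInterval :=
  {x | IsInterval m n x.1.1 x.1.2 ∧ x.2 = (m, n)}

/-- The tagged intervals of level `k`: those with `m + n = k`. -/
def fareyLevel (k : ℕ) : Set TaggedInterval :=
  {x | ∃ m n : ℕ, m + n = k ∧ x ∈ taggedIntervals m n}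

/-- The inter-level map on tagged intervals. For a tagged interval of index `(m + 1, n + 1)` exactly one of `b < r`, `b = r`,
`a = r`, `r < a` holds, where `r = (m + 1) / (n + 1)`; the infimum and the
supremum are the minimum and the maximum of a finite set. The index `(0, 0)` is not used. -/
noncomputable def fareyParent : TaggedInterval → TaggedInterval
  | ((a, b), (0, 0)) => ((a, b), (0, 0))
  | ((_, _), (0, n + 1)) => ((0, ⊤), (0, n))
  | ((_, _), (m + 1, 0)) => ((0, ⊤), (m, 0))
  | ((a, b), (m + 1, n + 1)) =>
    let r : EReal := ((((m + 1 : ℕ) : ℝ) / ((n + 1 : ℕ) : ℝ) : ℝ) : EReal)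
    if b < r then ((a, b), (m, n + 1))
    else if b = r then ((a, sInf {c | c ∈ fractions m (n + 1) ∧ a < c}), (m, n + 1))
    else if a = r then ((sSup {c | c ∈ fractions (m + 1) n ∧ c < b}, b), (m + 1, n))
    else ((a, b), (m + 1, n))

/-! ## Terminal pairs of difference equation type -/

/-- The domain `([m] × {1}) ∪ ({1} × [n])` of L-shapes. -/
def lDomain (m n : ℕ) : Set (ℕ × ℕ) :=
  (Set.Icc 1 m ×ˢ {1}) ∪ ({1} ×ˢ Set.Icc 1 n)

/-- The difference equations for a map on the domain of L-shapes. -/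
def DifferenceEquation (m n : ℕ) (f : ℕ × ℕ → ℕ) : Prop :=
  (∀ i ∈ Finset.Icc 1 (m - 1),
    (f (i + 1, 1) : ℤ) - f (i, 1) = ∑ t ∈ Finset.Icc 1 n, if f (1, t) ≤ f (i + 1, 1) then 1 else 0) ∧
  (∀ j ∈ Finset.Icc 1 (n - 1),
    (f (1, j + 1) : ℤ) - f (1, j) = ∑ s ∈ Finset.Icc 1 m, if f (s, 1) ≤ f (1, j + 1) then 1 else 0)

/-- `f` restricts to an injective L-shape of difference equation type of size `(m, n)`. A map on the
domain of L-shapes is represented by any extension of it to `ℕ × ℕ`; only the values on the domain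
are constrained. -/
def IsInjectiveLShape (m n : ℕ) (f : ℕ × ℕ → ℕ) : Prop :=
  Set.MapsTo f (lDomain m n) (Set.Icc 1 (m * n)) ∧ Set.InjOn f (lDomain m n) ∧
    DifferenceEquation m n f ∧ f (1, 1) = 1

/-- A pair `(s, t)` tagged with a double index: `(s, t, (m, n))`. -/
abbrev TaggedPair : Type := ℕ × ℕ × (ℕ × ℕ)

/-- The terminal pairs of difference equation type of size `(m, n)`, where `m, n ≥ 1`. -/
def terminalPairs (m n : ℕ) : Set TaggedPair :=
  {z | ∃ f : ℕ × ℕ → ℕ, IsInjectiveLShape m n f ∧ z = (f (m, 1), f (1, n), (m, n))}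

/-- The terminal pairs of difference equation type with `m + n = k`. -/
def terminalLevel (k : ℕ) : Set TaggedPair :=
  {z | ∃ m n : ℕ, 1 ≤ m ∧ 1 ≤ n ∧ m + n = k ∧ z ∈ terminalPairs m n}

/-- The inter-level map on terminal pairs. (For a terminal pair with `m + n ≥ 3` one has `s ≠ t`,
and no subtraction is truncated.) -/
def terminalParent : TaggedPair → TaggedPair
  | (s, t, (m, n)) => if t < s then (s - n, t, (m - 1, n)) else (s, t - m, (m, n - 1))

/-- The simple recursive rule: `(s, t, (m, n))` has the horizontal child `(s + n, t, (m + 1, n))`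
if `s - t > -n` and the vertical child `(s, t + m, (m, n + 1))` if `s - t < m`. -/
def ChildRule : TaggedPair → TaggedPair → Prop
  | (s, t, (m, n)), w =>
    ((s : ℤ) - t > -n ∧ w = (s + n, t, (m + 1, n))) ∨ ((s : ℤ) - t < m ∧ w = (s, t + m, (m, n + 1)))

/-! ## Young terminal pairs -/

/-- The ranking table of size `(m, n)` with parameter `ξ`. -/
noncomputable def rankingTable (m n : ℕ) (ξ : ℝ) (x : ℕ × ℕ) : ℕ :=
  ∑ s ∈ Finset.Icc 1 m, ∑ t ∈ Finset.Icc 1 n,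
    if (s : ℝ) + (t : ℝ) * ξ ≤ (x.1 : ℝ) + (x.2 : ℝ) * ξ then 1 else 0

/-- The Young terminal pairs of size `(m, n)`: the terminal pairs of the ranking tables with a
parameter `ξ > 0` that are injective on `[m] × [n]`. -/
def youngPairs (m n : ℕ) : Set TaggedPair :=
  {z | ∃ ξ : ℝ, 0 < ξ ∧ Set.InjOn (rankingTable m n ξ) (Set.Icc 1 m ×ˢ Set.Icc 1 n) ∧
    z = (rankingTable m n ξ (m, 1), rankingTable m n ξ (1, n), (m, n))}

/-- The Young terminal pairs with `m + n = k`. -/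
def youngLevel (k : ℕ) : Set TaggedPair :=
  {z | ∃ m n : ℕ, 1 ≤ m ∧ 1 ≤ n ∧ m + n = k ∧ z ∈ youngPairs m n}

/-- The terminal pair of the ranking table of size `(m + 1, n + 1)` with parameter `ξ`. -/
noncomputable def rankingPair (m n : ℕ) (ξ : ℝ) : TaggedPair :=
  (rankingTable (m + 1) (n + 1) ξ (m + 1, 1), rankingTable (m + 1) (n + 1) ξ (1, n + 1),
    (m + 1, n + 1))

/-- Yet another Surányi's map: `((a, b), (m, n))` is sent to the terminal pair of the ranking table
of size `(m + 1, n + 1)` with an arbitrarily chosen real parameter `ξ` in the interval `(a, b)`. -/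
noncomputable def suranyi : TaggedInterval → TaggedPair
  | ((a, b), (m, n)) =>
    rankingPair m n (Classical.epsilon fun ξ : ℝ => a < (ξ : EReal) ∧ (ξ : EReal) < b)

/-! ## The two trees of height `N` -/

/-- The vertices of levels `0, …, N` of a sequence of levels. -/
abbrev Vertex {α : Type} (level : ℕ → Set α) (N : ℕ) : Type := Σ k : Fin (N + 1), level k

/-- The graph on the levels `0, …, N` in which a vertex of level `k + 1` is adjacent to its image
under the inter-level map `parent` in level `k`, and there are no other edges. -/
def levelGraph {α : Type} (level : ℕ → Set α) (parent : α → α) (N : ℕ) :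
    SimpleGraph (Vertex level N) where
  Adj x y :=
    ((y.1 : ℕ) = (x.1 : ℕ) + 1 ∧ parent y.2 = x.2) ∨ ((x.1 : ℕ) = (y.1 : ℕ) + 1 ∧ parent x.2 = y.2)
  symm := ⟨fun _ _ h => h.symm⟩
  loopless := ⟨fun _ h => by rcases h with h | h <;> omega⟩

/-- The tree of generalized Farey intervals. -/
noncomputable def fareyTree (N : ℕ) : SimpleGraph (Vertex fareyLevel N) :=
  levelGraph fareyLevel fareyParent N

/-- The tree of terminal pairs of difference equation type; its level `k` consists of the pairs with
`m + n = k + 2`. -/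
def terminalTree (N : ℕ) : SimpleGraph (Vertex (fun k => terminalLevel (k + 2)) N) :=
  levelGraph (fun k => terminalLevel (k + 2)) terminalParent N

theorem fareyRoot_mem : (((0, ⊤), (0, 0)) : TaggedInterval) ∈ fareyLevel 0 := by
  refine ⟨0, 0, rfl, ⟨?_, ?_, ?_, ?_⟩, rfl⟩ <;> simp [fractions]

theorem terminalRoot_mem : ((1, 1, (1, 1)) : TaggedPair) ∈ terminalLevel (0 + 2) := by
  refine ⟨1, 1, le_rfl, le_rfl, rfl, fun _ => 1, ⟨?_, ?_, ?_, rfl⟩, rfl⟩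
  · intro x _
    simp
  · intro x hx y hy _
    simp only [lDomain, Set.Icc_self, Set.singleton_prod_singleton, Set.union_self,
      Set.mem_singleton_iff] at hx hy
    rw [hx, hy]
  · simp [DifferenceEquation]

/-- The root `((0, ∞), (0, 0))`. -/
noncomputable def fareyRoot (N : ℕ) : Vertex fareyLevel N := ⟨0, ⟨_, fareyRoot_mem⟩⟩

/-- The root `(1, 1, (1, 1))`. -/
def terminalRoot (N : ℕ) : Vertex (fun k => terminalLevel (k + 2)) N := ⟨0, ⟨_, terminalRoot_mem⟩⟩

end FareyTree

namespace FareyTree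

/-! Both the Young terminal pairs and the terminal pairs of difference equation type grow from `(1,
1, (1, 1))` by the same rule, so they coincide level by level. Surányi's map then transports the
Farey tree to that common tree.

Ranking side. For index `(m, n)` and generic `ξ`, the order of the two entries of the pair tells on
which side of the corner `m / n` the parameter lies. If `ξ < m / n`, the pair comes from index `(m -
1, n)` by adding `n + 1` to the first entry (`rankingPair_succ_left`); the other side is symmetric
under `ξ ↦ ξ⁻¹`. By induction two generic parameters have equal pairs exactly when they compare
alike with all the fractions (`rankingPair_eq_iff`). This makes Surányi's map well defined and
injective. It commutes with the parent maps because the parent interval contains the given one, so a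
single `ξ` serves both.

The hard point is that every child allowed by the rule is realized by some parameter. A parameter
beyond `(m + 1) / n` has to be moved back across that value without crossing a fraction of index
`(m, n)`. A fraction in the way would force `s + (n + 1) ≤ t` (`rankingPair_add_le`), which is
precisely what the rule excludes.

Difference equation side. The larger of the two terminal values is the maximum of the L-shape, so
its last increment counts the whole other arm. It can be deleted, and conversely a new maximum can
be appended (`IsInjectiveLShape.restrict_fst`, `IsInjectiveLShape.extend_fst`). -/

theorem sum_Icc_one_succ {M : Type*} [AddCommMonoid M] (g : ℕ → M) (m : ℕ) :
    ∑ s ∈ Finset.Icc 1 (m + 1), g s = g 1 + ∑ s ∈ Finset.Icc 1 m, g (s + 1) := by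
  induction m with
  | zero => simp
  | succ m ih =>
    rw [Finset.sum_Icc_succ_top (by omega), ih, Finset.sum_Icc_succ_top (by omega), add_assoc]

theorem ite_one_zero_le_of_imp {P Q : Prop} [Decidable P] [Decidable Q] (h : P → Q) :
    (if P then 1 else 0) ≤ if Q then 1 else 0 := by
  split_ifs with hP hQ
  · exact le_rfl
  · exact absurd (h hP) hQ
  · exact zero_le_one
  · exact le_rfl

/-! ## Ranking tables -/

theorem rankingTable_lt_rankingTable {m n : ℕ} {ξ : ℝ} {x y : ℕ × ℕ}
    (h1 : y.1 ∈ Finset.Icc 1 m) (h2 : y.2 ∈ Finset.Icc 1 n)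
    (h : (x.1 : ℝ) + x.2 * ξ < y.1 + y.2 * ξ) :
    rankingTable m n ξ x < rankingTable m n ξ y := by
  have key : ∀ s t : ℕ, (if (s : ℝ) + t * ξ ≤ x.1 + x.2 * ξ then 1 else 0) ≤
      (if (s : ℝ) + t * ξ ≤ y.1 + y.2 * ξ then 1 else 0) := by
    exact fun s t => ite_one_zero_le_of_imp fun h3 => h3.trans h.le
  refine Finset.sum_lt_sum (fun s _ => Finset.sum_le_sum fun t _ => key s t)
    ⟨y.1, h1, Finset.sum_lt_sum (fun t _ => key y.1 t) ⟨y.2, h2, ?_⟩⟩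
  rw [if_neg (not_le.2 h), if_pos le_rfl]
  exact zero_lt_one

/-- Dividing every value `s + tξ` by `ξ` transposes the table. All vertical statements are deduced
from horizontal ones in this way. -/
theorem rankingTable_swap (m n : ℕ) {ξ : ℝ} (hξ : 0 < ξ) (i j : ℕ) :
    rankingTable n m ξ⁻¹ (j, i) = rankingTable m n ξ (i, j) := by
  unfold rankingTable
  rw [Finset.sum_comm]
  refine Finset.sum_congr rfl fun s _ => Finset.sum_congr rfl fun t _ => ?_
  congr 1
  rw [← mul_le_mul_iff_of_pos_left hξ]
  have e1 : ξ * ((t : ℝ) + s * ξ⁻¹) = s + t * ξ := by field_simp; ring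
  have e2 : ξ * ((j : ℝ) + i * ξ⁻¹) = i + j * ξ := by field_simp; ring
  simp only [e1, e2]

/-- The points with `s = 1` all lie below the corner `(m + 2, 1)` and contribute `n + 1`; the others
are the smaller table translated by one. -/
theorem rankingTable_succ_left_fst {m n : ℕ} {ξ : ℝ} (hξ : 0 < ξ) (h : ξ * n < m + 1) :
    rankingTable (m + 2) (n + 1) ξ (m + 2, 1) =
      rankingTable (m + 1) (n + 1) ξ (m + 1, 1) + (n + 1) := by
  unfold rankingTable
  rw [sum_Icc_one_succ, add_comm]
  congr 1
  · refine Finset.sum_congr rfl fun s _ => Finset.sum_congr rfl fun t _ => ?_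
    congr 1
    push_cast
    apply propext
    constructor <;> intro h <;> linarith
  · rw [Finset.sum_congr rfl (g := fun _ => 1), Finset.sum_const, Nat.card_Icc, smul_eq_mul,
      mul_one, Nat.add_sub_cancel]
    intro t ht
    rw [if_pos]
    have : (t : ℝ) ≤ n + 1 := by exact_mod_cast (Finset.mem_Icc.1 ht).2
    push_cast
    nlinarith

/-- The points with `s = m + 2` all lie above `(1, n + 1)`, so they do not affect its rank. -/
theorem rankingTable_succ_left_snd {m n : ℕ} {ξ : ℝ} (hξ : 0 < ξ) (h : ξ * n < m + 1) :
    rankingTable (m + 2) (n + 1) ξ (1, n + 1) = rankingTable (m + 1) (n + 1) ξ (1, n + 1) := by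
  unfold rankingTable
  rw [Finset.sum_Icc_succ_top (by omega), Nat.add_eq_left]
  refine Finset.sum_eq_zero fun t ht => ?_
  rw [if_neg]
  have : (1 : ℝ) ≤ t := by exact_mod_cast (Finset.mem_Icc.1 ht).1
  push_cast
  nlinarith

theorem rankingPair_succ_left {m n : ℕ} {ξ : ℝ} (hξ : 0 < ξ) (h : ξ * n < m + 1) :
    rankingPair (m + 1) n ξ =
      ((rankingPair m n ξ).1 + (n + 1), (rankingPair m n ξ).2.1, (m + 1 + 1, n + 1)) := by
  simp only [rankingPair, rankingTable_succ_left_fst hξ h, rankingTable_succ_left_snd hξ h]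

theorem rankingPair_swap (m n : ℕ) {ξ : ℝ} (hξ : 0 < ξ) :
    rankingPair n m ξ⁻¹ =
      ((rankingPair m n ξ).2.1, (rankingPair m n ξ).1, (n + 1, m + 1)) := by
  simp only [rankingPair, rankingTable_swap _ _ hξ]

theorem rankingPair_succ_right {m n : ℕ} {ξ : ℝ} (hξ : 0 < ξ) (h : m < ξ * (n + 1)) :
    rankingPair m (n + 1) ξ =
      ((rankingPair m n ξ).1, (rankingPair m n ξ).2.1 + (m + 1), (m + 1, n + 1 + 1)) := by
  have h' : ξ⁻¹ * m < n + 1 := by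
    rw [inv_mul_lt_iff₀ hξ]
    exact h
  have e := rankingPair_succ_left (inv_pos.2 hξ) h'
  rw [rankingPair_swap _ _ hξ, rankingPair_swap _ _ hξ] at e
  simp only [Prod.mk.injEq] at e
  ext
  · exact e.2.1
  · exact e.1
  · rfl
  · rfl

theorem rankingPair_snd_lt_fst {m n : ℕ} {ξ : ℝ} (h : ξ * n < m) :
    (rankingPair m n ξ).2.1 < (rankingPair m n ξ).1 := by
  refine rankingTable_lt_rankingTable (by simp) (by simp) ?_
  push_cast
  linarith

theorem rankingPair_fst_lt_snd {m n : ℕ} {ξ : ℝ} (h : m < ξ * n) :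
    (rankingPair m n ξ).1 < (rankingPair m n ξ).2.1 := by
  refine rankingTable_lt_rankingTable (by simp) (by simp) ?_
  push_cast
  linarith

theorem rankingPair_zero_zero {ξ : ℝ} : rankingPair 0 0 ξ = (1, 1, (1, 1)) := by
  simp [rankingPair, rankingTable, Finset.filter_singleton]

/-! ### Generic parameters and their position among the fractions -/

/-- The parameter `ξ` is not one of the fractions `p / q` with `1 ≤ p ≤ m` and `1 ≤ q ≤ n`. -/
def Generic (m n : ℕ) (ξ : ℝ) : Prop :=
  ∀ p q : ℕ, 1 ≤ p → p ≤ m → 1 ≤ q → q ≤ n → ξ * q ≠ p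

/-- The parameters `ξ` and `η` compare in the same way with the fractions `p / q`. -/
def SameSide (m n : ℕ) (ξ η : ℝ) : Prop :=
  ∀ p q : ℕ, 1 ≤ p → p ≤ m → 1 ≤ q → q ≤ n → (ξ * q < p ↔ η * q < p)

theorem Generic.mono {m n m' n' : ℕ} {ξ : ℝ} (h : Generic m n ξ) (hm : m' ≤ m) (hn : n' ≤ n) :
    Generic m' n' ξ :=
  fun p q h1 h2 h3 h4 => h p q h1 (h2.trans hm) h3 (h4.trans hn)

theorem SameSide.mono {m n m' n' : ℕ} {ξ η : ℝ} (h : SameSide m n ξ η) (hm : m' ≤ m)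
    (hn : n' ≤ n) : SameSide m' n' ξ η :=
  fun p q h1 h2 h3 h4 => h p q h1 (h2.trans hm) h3 (h4.trans hn)

theorem Generic.inv {m n : ℕ} {ξ : ℝ} (hξ : 0 < ξ) (h : Generic m n ξ) : Generic n m ξ⁻¹ := by
  intro p q h1 h2 h3 h4 e
  refine h q p h3 h4 h1 h2 ?_
  rw [← e]
  field_simp

/-- The corner fraction `m / n` is on one side of a generic parameter. -/
theorem Generic.corner {m n k : ℕ} {ξ : ℝ} (hξ : 0 < ξ) (h : Generic m n ξ) (hk : m + n = k + 1) :
    (∃ m', m = m' + 1 ∧ ξ * n < m) ∨ (∃ n', n = n' + 1 ∧ m < ξ * n) := by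
  rcases m with _ | m
  · exact Or.inr ⟨k, by omega, by rw [show n = k + 1 by omega]; push_cast; positivity⟩
  rcases n with _ | n
  · exact Or.inl ⟨m, rfl, by push_cast; rw [mul_zero]; positivity⟩
  rcases lt_or_gt_of_ne (h (m + 1) (n + 1) (by omega) le_rfl (by omega) le_rfl) with h1 | h1
  · exact Or.inl ⟨m, rfl, h1⟩
  · exact Or.inr ⟨n, rfl, h1⟩

theorem SameSide.corner {m n : ℕ} {ξ η : ℝ} (h : SameSide m n ξ η) (hlt : ξ * n < m) (hm : 1 ≤ m) : η * n < m := by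
  rcases n with _ | n
  · push_cast; rw [mul_zero]; exact_mod_cast hm
  · exact (h m (n + 1) hm le_rfl (by omega) le_rfl).1 hlt

theorem SameSide.symm {m n : ℕ} {ξ η : ℝ} (h : SameSide m n ξ η) : SameSide m n η ξ :=
  fun p q h1 h2 h3 h4 => (h p q h1 h2 h3 h4).symm

/-- Induction on `m + n`. Either side of the equivalence puts `ξ` and `η` on the same side of the
corner `m / n`; both pairs then arise by the same shift from one smaller index, and the fractions
lost in passing to it cannot separate the parameters. -/
theorem rankingPair_eq_iff {m n : ℕ} {ξ η : ℝ} (hξ : 0 < ξ) (hη : 0 < η) (gξ : Generic m n ξ)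
    (gη : Generic m n η) : rankingPair m n ξ = rankingPair m n η ↔ SameSide m n ξ η := by
  induction hk : m + n generalizing m n with
  | zero =>
    obtain ⟨rfl, rfl⟩ : m = 0 ∧ n = 0 := by omega
    simp only [rankingPair_zero_zero, true_iff]
    intro p q h1 h2
    omega
  | succ k ih =>
    have hcorner : rankingPair m n ξ = rankingPair m n η ∨ SameSide m n ξ η →
        ((∃ m', m = m' + 1 ∧ ξ * n < m) ∧ η * n < m) ∨
        ((∃ n', n = n' + 1 ∧ m < ξ * n) ∧ m < η * n) := by
      intro H
      rcases gξ.corner hξ hk with h1 | h1 <;> rcases gη.corner hη hk with h2 | h2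
      · exact Or.inl ⟨h1, h2.choose_spec.2⟩
      · exfalso
        obtain ⟨m', rfl, h1⟩ := h1
        obtain ⟨n', rfl, h2⟩ := h2
        rcases H with H | H
        · have := rankingPair_snd_lt_fst h1
          rw [H] at this
          exact this.asymm (rankingPair_fst_lt_snd h2)
        · exact h2.asymm (H.corner h1 (by omega))
      · exfalso
        obtain ⟨n', rfl, h1⟩ := h1
        obtain ⟨m', rfl, h2⟩ := h2
        rcases H with H | H
        · have := rankingPair_fst_lt_snd h1
          rw [H] at this
          exact this.asymm (rankingPair_snd_lt_fst h2)
        · exact h1.asymm (H.symm.corner h2 (by omega))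
      · exact Or.inr ⟨h1, h2.choose_spec.2⟩
    by_cases hs : rankingPair m n ξ = rankingPair m n η ∨ SameSide m n ξ η
    swap
    · rw [not_or] at hs
      simp [hs.1, hs.2]
    rcases hcorner hs with ⟨⟨m', rfl, h1⟩, h2⟩ | ⟨⟨n', rfl, h1⟩, h2⟩
    · have ih := @ih m' n (gξ.mono (by omega) le_rfl) (gη.mono (by omega) le_rfl) (by omega)
      have e : rankingPair (m' + 1) n ξ = rankingPair (m' + 1) n η ↔
          rankingPair m' n ξ = rankingPair m' n η := by
        push_cast at h1 h2
        rw [rankingPair_succ_left hξ h1, rankingPair_succ_left hη h2]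
        simp only [Prod.ext_iff, rankingPair]
        simp
      rw [e, ih]
      refine ⟨fun h p q hp hpm hq hqn => ?_, fun h => h.mono (by omega) le_rfl⟩
      rcases hpm.lt_or_eq with hlt | rfl
      · exact h p q hp (by omega) hq hqn
      -- A fraction with the new numerator is at least the corner, hence above both parameters.
      · have : (q : ℝ) ≤ n := by exact_mod_cast hqn
        exact iff_of_true (by nlinarith) (by nlinarith)
    · have ih := @ih m n' (gξ.mono le_rfl (by omega)) (gη.mono le_rfl (by omega)) (by omega)
      have e : rankingPair m (n' + 1) ξ = rankingPair m (n' + 1) η ↔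
          rankingPair m n' ξ = rankingPair m n' η := by
        push_cast at h1 h2
        rw [rankingPair_succ_right hξ h1, rankingPair_succ_right hη h2]
        simp only [Prod.ext_iff, rankingPair]
        simp
      rw [e, ih]
      refine ⟨fun h p q hp hpm hq hqn => ?_, fun h => h.mono le_rfl (by omega)⟩
      rcases hqn.lt_or_eq with hlt | rfl
      · exact h p q hp hpm hq (by omega)
      · have : (p : ℝ) ≤ m := by exact_mod_cast hpm
        exact iff_of_false (by linarith) (by linarith)

/-- If some fraction `p / q` separates `(m + 1) / n` from `ξ`, then the terminal pair of the ranking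
table does not allow a horizontal child. -/
theorem rankingPair_add_le {m n p q : ℕ} {ξ : ℝ} (hξ : 0 < ξ) (hp : 1 ≤ p) (hpm : p ≤ m)
    (hq : 1 ≤ q) (hpq : p < ξ * q) (hle : (m + 1) * q ≤ p * n) :
    (rankingPair m n ξ).1 + (n + 1) ≤ (rankingPair m n ξ).2.1 := by
  have hqn : q < n := by
    by_contra! h
    have : p * n ≤ m * q := Nat.mul_le_mul hpm h
    nlinarith
  have hle' : ((m : ℝ) + 1) * q ≤ p * n := by exact_mod_cast hle
  have hq' : (1 : ℝ) ≤ q := by exact_mod_cast hq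
  have hn' : (q : ℝ) + 1 ≤ n := by exact_mod_cast hqn
  have hnξ : (m : ℝ) + 1 < ξ * n := by
    have : ((m : ℝ) + 1) * q < (ξ * n) * q := by nlinarith
    exact lt_of_mul_lt_mul_right this (by linarith)
  simp only [rankingPair, rankingTable]
  rw [Finset.sum_comm, Finset.sum_comm (s := Finset.Icc 1 (m + 1)), sum_Icc_one_succ,
    sum_Icc_one_succ _ n]
  -- The two ranks are compared row by row. Each row `j + 1` with `1 ≤ j ≤ n` supplies one point
  -- counted only for `(1, n + 1)`, and the row with `j = n - q` supplies two, which makes `n + 1`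
  -- in all.
  have hcount : n + 1 = ∑ j ∈ Finset.Icc 1 n, (1 + if j = n - q then 1 else 0) := by
    rw [Finset.sum_add_distrib, Finset.sum_ite_eq' _ _ fun _ => 1, if_pos (by simp; omega)]
    simp
  refine (congrArg (HAdd.hAdd _) hcount).le.trans ?_
  rw [add_assoc, ← Finset.sum_add_distrib]
  refine add_le_add ?_ (Finset.sum_le_sum fun j hj => ?_)
  · refine Finset.sum_le_sum fun i _ => ?_
    refine ite_one_zero_le_of_imp fun h => ?_
    push_cast at h ⊢
    linarith
  obtain ⟨hj1, hjn⟩ := Finset.mem_Icc.1 hj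
  have hj1' : (1 : ℝ) ≤ j := by exact_mod_cast hj1
  have hjn' : (j : ℝ) ≤ n := by exact_mod_cast hjn
  have key : ∀ i : ℕ, ((i : ℝ) + (j + 1 : ℕ) * ξ ≤ (m + 1 : ℕ) + (1 : ℕ) * ξ) →
      (i : ℝ) + (j + 1 : ℕ) * ξ ≤ (1 : ℕ) + (n + 1 : ℕ) * ξ := by
    push_cast
    intro i h
    linarith
  by_cases hjq : j = n - q
  · have hj' : (j : ℝ) = n - q := by rw [hjq, Nat.cast_sub hqn.le]
    -- The two extra points are `i = p` and `i = p + 1`: `p < ξ * q` keeps both below `(1, n + 1)`,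
    -- and `(m + 1) * q ≤ p * n` puts both above `(m + 1, 1)`.
    have hc : (1 + if j = n - q then 1 else 0) = ∑ i ∈ Finset.Icc 1 (m + 1),
        ((if i = p + 1 then 1 else 0) + if i = p then 1 else 0) := by
      rw [Finset.sum_add_distrib, Finset.sum_ite_eq' _ _ fun _ => 1,
        Finset.sum_ite_eq' _ _ fun _ => 1, if_pos hjq, if_pos (by simp; omega),
        if_pos (by simp; omega)]
    rw [hc, ← Finset.sum_add_distrib]
    have hlow : (m : ℝ) + 1 < p + (n - q) * ξ := by
      have : ((m : ℝ) + 1) * q < (p + (n - q) * ξ) * q := by nlinarith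
      exact lt_of_mul_lt_mul_right this (by linarith)
    refine Finset.sum_le_sum fun i _ => ?_
    by_cases hi1 : i = p + 1
    · subst hi1
      rw [if_neg, if_pos rfl, if_neg (by omega), if_pos]
      · push_cast
        rw [hj']
        nlinarith
      · push_cast
        rw [hj']
        nlinarith
    by_cases hi2 : i = p
    · subst hi2
      rw [if_neg, if_neg (by omega), if_pos rfl, if_pos]
      · push_cast
        rw [hj']
        nlinarith
      · push_cast
        rw [hj']
        nlinarith
    rw [if_neg hi1, if_neg hi2]
    exact ite_one_zero_le_of_imp (key i)
  · have hnj : 0 ≤ ((n : ℝ) - j) * ξ := mul_nonneg (by linarith) hξ.le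
    obtain ⟨F, hfl, hfl'⟩ : ∃ F : ℕ, (F : ℝ) ≤ ((n : ℝ) - j) * ξ ∧ ((n : ℝ) - j) * ξ < F + 1 :=
      ⟨_, Nat.floor_le hnj, Nat.lt_floor_add_one _⟩
    -- `F + 1` is the last column counted for `(1, n + 1)` in an unbounded row; the row is cut at `m
    -- + 1`. The resulting `i₀` lies above `(m + 1, 1)` in either case.
    obtain ⟨i₀, hi1, him, hiF, hor⟩ :
        ∃ i₀ : ℕ, 1 ≤ i₀ ∧ i₀ ≤ m + 1 ∧ i₀ ≤ F + 1 ∧ (i₀ = m + 1 ∨ i₀ = F + 1) :=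
      ⟨min (m + 1) (F + 1), by omega, by omega, by omega, by omega⟩
    have hup : (i₀ : ℝ) ≤ F + 1 := by exact_mod_cast hiF
    have hlow : (m : ℝ) + 1 < i₀ + j * ξ := by
      rcases hor with rfl | rfl
      · push_cast
        nlinarith
      · push_cast
        linarith
    have hc : (1 + if j = n - q then 1 else 0) = ∑ i ∈ Finset.Icc 1 (m + 1),
        (if i = i₀ then 1 else 0) := by
      rw [Finset.sum_ite_eq' _ _ fun _ => 1, if_neg hjq, if_pos (by simp; omega)]
    rw [hc, ← Finset.sum_add_distrib]
    refine Finset.sum_le_sum fun i _ => ?_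
    by_cases hi : i = i₀
    · rw [hi, if_neg, if_pos rfl, if_pos]
      · push_cast
        linarith
      · push_cast
        linarith
    rw [if_neg hi]
    exact ite_one_zero_le_of_imp (key i)

/-- A parameter whose terminal pair allows a horizontal child can be moved, without changing the
pair, to the left of `(m + 1) / n`. -/
theorem exists_param_left {m n : ℕ} {ξ : ℝ} (hξ : 0 < ξ) (gξ : Generic m n ξ)
    (h : (rankingPair m n ξ).2.1 < (rankingPair m n ξ).1 + (n + 1)) :
    ∃ η : ℝ, 0 < η ∧ Generic (m + 1) n η ∧ η * n < m + 1 ∧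
      rankingPair m n η = rankingPair m n ξ := by
  have gen : ∀ η : ℝ, 0 < η → Generic m n η → η * n < m + 1 → Generic (m + 1) n η := by
    intro η hη g hlt p q hp hpm hq hqn
    rcases hpm.lt_or_eq with h1 | rfl
    · exact g p q hp (by omega) hq hqn
    · have : (q : ℝ) ≤ n := by exact_mod_cast hqn
      push_cast
      nlinarith
  by_cases hlt : ξ * n < m + 1
  · exact ⟨ξ, hξ, gen ξ hξ gξ hlt, hlt, rfl⟩
  have hn : 0 < n := by
    rcases Nat.eq_zero_or_pos n with rfl | h0
    · exfalso
      apply hlt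
      push_cast
      rw [mul_zero]
      positivity
    · exact h0
  have hn' : (0 : ℝ) < n := by exact_mod_cast hn
  set r : ℝ := (m + 1) / n with hr
  -- The new parameter is chosen just left of `r`, to the right of all the finitely many fractions
  -- below `r`.
  have hev : ∀ᶠ η in nhdsWithin r (Set.Iio r), η < r ∧ 0 < η ∧
      ∀ p ∈ Finset.Icc 1 m, ∀ q ∈ Finset.Icc 1 n, (p : ℝ) / q < r → (p : ℝ) / q < η := by
    have hgt : ∀ x < r, ∀ᶠ η in nhdsWithin r (Set.Iio r), x < η := fun x hx =>
      eventually_nhdsWithin_of_eventually_nhds (eventually_gt_nhds hx)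
    refine Filter.Eventually.and self_mem_nhdsWithin ((hgt 0 (by positivity)).and ?_)
    refine (Filter.eventually_all_finset _).2 fun p _ =>
      (Filter.eventually_all_finset _).2 fun q _ => ?_
    by_cases hpq : (p : ℝ) / q < r
    · filter_upwards [hgt _ hpq] with η hη _ using hη
    · exact Filter.Eventually.of_forall fun η h => absurd h hpq
  obtain ⟨η, hηr, hη, hfr⟩ := hev.exists
  have hηn : η * n < m + 1 := (lt_div_iff₀ hn').1 hηr
  have hcmp : ∀ p q : ℕ, 1 ≤ p → p ≤ m → 1 ≤ q → q ≤ n →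
      ((p : ℝ) < ξ * q ∧ (p : ℝ) < η * q) ∨ (ξ * q < p ∧ η * q < p) := by
    intro p q hp hpm hq hqn
    have hq' : (0 : ℝ) < q := by exact_mod_cast hq
    rcases lt_or_ge (p * n) ((m + 1) * q) with hc | hc
    · have hc' : (p : ℝ) * n < (m + 1) * q := by exact_mod_cast hc
      left
      constructor
      · have : (p : ℝ) * n < (ξ * q) * n := by nlinarith [not_lt.1 hlt]
        exact lt_of_mul_lt_mul_right this hn'.le
      · refine (div_lt_iff₀ hq').1 (hfr p (by simp; omega) q (by simp; omega) ?_)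
        rw [hr, div_lt_div_iff₀ hq' hn']
        exact hc'
    · have hc' : ((m : ℝ) + 1) * q ≤ p * n := by exact_mod_cast hc
      right
      constructor
      -- Here `r ≤ p / q`. If `p / q` were less than `ξ`, `rankingPair_add_le` would contradict the
      -- hypothesis on the pair.
      · refine lt_of_le_of_ne (not_lt.1 fun hlt' => ?_) (gξ p q hp hpm hq hqn)
        have := rankingPair_add_le hξ hp hpm hq hlt' hc
        omega
      · have : (η * q) * n < p * n := by nlinarith
        exact lt_of_mul_lt_mul_right this hn'.le
  have gη : Generic m n η := by
    intro p q hp hpm hq hqn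
    rcases hcmp p q hp hpm hq hqn with h | h
    · exact h.2.ne'
    · exact h.2.ne
  refine ⟨η, hη, gen η hη gη hηn, hηn, (rankingPair_eq_iff hη hξ gη gξ).2 ?_⟩
  intro p q hp hpm hq hqn
  rcases hcmp p q hp hpm hq hqn with h | h
  · exact iff_of_false h.2.not_gt h.1.not_gt
  · exact iff_of_true h.2 h.1

theorem exists_param_right {m n : ℕ} {ξ : ℝ} (hξ : 0 < ξ) (gξ : Generic m n ξ)
    (h : (rankingPair m n ξ).1 < (rankingPair m n ξ).2.1 + (m + 1)) :
    ∃ η : ℝ, 0 < η ∧ Generic m (n + 1) η ∧ m < η * (n + 1) ∧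
      rankingPair m n η = rankingPair m n ξ := by
  obtain ⟨η, hη, gη, hlt, e⟩ := exists_param_left (inv_pos.2 hξ) (gξ.inv hξ)
    (by rw [rankingPair_swap _ _ hξ]; exact h)
  refine ⟨η⁻¹, inv_pos.2 hη, gη.inv hη, ?_, ?_⟩
  · rw [lt_inv_mul_iff₀ hη]
    exact hlt
  · have e2 := rankingPair_swap n m hη
    rw [e, rankingPair_swap _ _ hξ] at e2
    exact e2

/-! ### Young terminal pairs and their recursive rule -/

theorem rankingTable_injOn_iff {m n : ℕ} {ξ : ℝ} (hξ : 0 < ξ) :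
    Set.InjOn (rankingTable (m + 1) (n + 1) ξ) (Set.Icc 1 (m + 1) ×ˢ Set.Icc 1 (n + 1)) ↔
      Generic m n ξ := by
  constructor
  · intro h p q hp hpm hq hqn e
    have := @h (1 + p, 1) ⟨by simp; omega, by simp⟩ (1, 1 + q) ⟨by simp, by simp; omega⟩ (by
      have e' : ((1 + p : ℕ) : ℝ) + (1 : ℕ) * ξ = (1 : ℕ) + (1 + q : ℕ) * ξ := by
        push_cast
        linarith
      simp only [rankingTable, e'])
    simp at this
    omega
  · rintro g ⟨i, j⟩ ⟨⟨hi1, hi2⟩, hj1, hj2⟩ ⟨i', j'⟩ ⟨⟨hi1', hi2'⟩, hj1', hj2'⟩ e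
    simp only at hi1 hi2 hj1 hj2 hi1' hi2' hj1' hj2'
    have hv : (i : ℝ) + j * ξ = i' + j' * ξ := by
      rcases lt_trichotomy ((i : ℝ) + j * ξ) (i' + j' * ξ) with hlt | heq | hgt
      · exact absurd e (rankingTable_lt_rankingTable (x := (i, j)) (y := (i', j')) (by simp; omega)
          (by simp; omega) hlt).ne
      · exact heq
      · exact absurd e (rankingTable_lt_rankingTable (x := (i', j')) (y := (i, j)) (by simp; omega)
          (by simp; omega) hgt).ne'
    -- A collision of distinct points forces `ξ` to be the ratio of the coordinate differences,
    -- which are at most `m` and `n`.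
    rcases lt_trichotomy j j' with hj | rfl | hj
    · have hj' : (j : ℝ) < j' := by exact_mod_cast hj
      have hi : i' < i := by
        have : (i' : ℝ) < i := by nlinarith
        exact_mod_cast this
      refine absurd ?_ (g (i - i') (j' - j) (by omega) (by omega) (by omega) (by omega))
      rw [Nat.cast_sub hi.le, Nat.cast_sub hj.le]
      linarith
    · have : (i : ℝ) = i' := by linarith
      rw [Nat.cast_injective this]
    · have hj' : (j' : ℝ) < j := by exact_mod_cast hj
      have hi : i < i' := by
        have : (i : ℝ) < i' := by nlinarith
        exact_mod_cast this
      refine absurd ?_ (g (i' - i) (j - j') (by omega) (by omega) (by omega) (by omega))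
      rw [Nat.cast_sub hi.le, Nat.cast_sub hj.le]
      linarith

theorem mem_youngLevel_iff {k : ℕ} {z : TaggedPair} : z ∈ youngLevel (k + 2) ↔
    ∃ m n ξ, m + n = k ∧ 0 < ξ ∧ Generic m n ξ ∧ z = rankingPair m n ξ := by
  constructor
  · rintro ⟨m, n, hm, hn, hk, ξ, hξ, hi, rfl⟩
    obtain ⟨m, rfl⟩ := Nat.exists_eq_add_of_le' hm
    obtain ⟨n, rfl⟩ := Nat.exists_eq_add_of_le' hn
    exact ⟨m, n, ξ, by omega, hξ, (rankingTable_injOn_iff hξ).1 hi, rfl⟩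
  · rintro ⟨m, n, ξ, hk, hξ, g, rfl⟩
    exact ⟨m + 1, n + 1, by omega, by omega, by omega, ξ, hξ, (rankingTable_injOn_iff hξ).2 g, rfl⟩

theorem youngLevel_two : youngLevel 2 = {(1, 1, (1, 1))} := by
  ext z
  rw [mem_youngLevel_iff, Set.mem_singleton_iff]
  constructor
  · rintro ⟨m, n, ξ, hk, -, -, rfl⟩
    obtain ⟨rfl, rfl⟩ : m = 0 ∧ n = 0 := by omega
    exact rankingPair_zero_zero
  · rintro rfl
    exact ⟨0, 0, 1, rfl, one_pos, fun p q h1 h2 => by omega, rankingPair_zero_zero.symm⟩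

/-- Downwards, the side of the corner selects the parent and the order of the entries gives the
inequality of the rule. Upwards, the parameter is first moved past the new corner without changing
the pair. -/
theorem youngLevel_succ (k : ℕ) :
    youngLevel (k + 3) = {w | ∃ v ∈ youngLevel (k + 2), ChildRule v w} := by
  ext w
  rw [mem_youngLevel_iff (k := k + 1)]
  constructor
  · rintro ⟨m, n, ξ, hk, hξ, g, rfl⟩
    rcases g.corner hξ hk with ⟨m, rfl, h⟩ | ⟨n, rfl, h⟩
    · refine ⟨rankingPair m n ξ, mem_youngLevel_iff.2
        ⟨m, n, ξ, by omega, hξ, g.mono (by omega) le_rfl, rfl⟩, ?_⟩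
      have hlt := rankingPair_snd_lt_fst h
      push_cast at h
      have e := rankingPair_succ_left hξ h
      rw [e] at hlt
      refine Or.inl ⟨?_, e⟩
      simp only [rankingPair] at hlt ⊢
      push_cast
      omega
    · refine ⟨rankingPair m n ξ, mem_youngLevel_iff.2
        ⟨m, n, ξ, by omega, hξ, g.mono le_rfl (by omega), rfl⟩, ?_⟩
      have hlt := rankingPair_fst_lt_snd h
      push_cast at h
      have e := rankingPair_succ_right hξ h
      rw [e] at hlt
      refine Or.inr ⟨?_, e⟩
      simp only [rankingPair] at hlt ⊢
      push_cast
      omega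
  · rintro ⟨v, hv, hc⟩
    obtain ⟨m, n, ξ, hk, hξ, g, rfl⟩ := mem_youngLevel_iff.1 hv
    rcases hc with ⟨hc, rfl⟩ | ⟨hc, rfl⟩
    · obtain ⟨η, hη, gη, hlt, e⟩ := exists_param_left hξ g (by
        simp only [rankingPair]
        push_cast at hc
        omega)
      refine ⟨m + 1, n, η, by omega, hη, gη, ?_⟩
      rw [rankingPair_succ_left hη hlt, e]
      rfl
    · obtain ⟨η, hη, gη, hlt, e⟩ := exists_param_right hξ g (by
        simp only [rankingPair]
        push_cast at hc
        omega)
      refine ⟨m, n + 1, η, by omega, hη, gη, ?_⟩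
      rw [rankingPair_succ_right hη hlt, e]
      rfl

/-! ## Terminal pairs of difference equation type -/

theorem mem_lDomain {m n : ℕ} {x : ℕ × ℕ} :
    x ∈ lDomain m n ↔ (1 ≤ x.1 ∧ x.1 ≤ m ∧ x.2 = 1) ∨ (x.1 = 1 ∧ 1 ≤ x.2 ∧ x.2 ≤ n) := by
  simp [lDomain, and_assoc]

theorem IsInjectiveLShape.swap {m n : ℕ} {f : ℕ × ℕ → ℕ} (h : IsInjectiveLShape m n f) :
    IsInjectiveLShape n m (f ∘ Prod.swap) := by
  have hd : ∀ x, x ∈ lDomain n m → x.swap ∈ lDomain m n := by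
    intro x
    simp only [mem_lDomain, Prod.fst_swap, Prod.snd_swap]
    omega
  obtain ⟨hmaps, hinj, ⟨h1, h2⟩, hone⟩ := h
  refine ⟨fun x hx => ?_, fun x hx y hy e => ?_, ⟨h2, h1⟩, hone⟩
  · rw [mul_comm]
    exact hmaps (hd x hx)
  · exact Prod.swap_injective (hinj (hd x hx) (hd y hy) e)

/-- The increment is a count over `[n]` that always includes `t = 1`, since `f (1, 1) = 1`. -/
theorem IsInjectiveLShape.fst_step {m n : ℕ} {f : ℕ × ℕ → ℕ} (h : IsInjectiveLShape m n f)
    (hn : 1 ≤ n) {i : ℕ} (hi : 1 ≤ i) (him : i < m) :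
    f (i, 1) < f (i + 1, 1) ∧ f (i + 1, 1) ≤ f (i, 1) + n := by
  obtain ⟨hmaps, -, ⟨h1, -⟩, hone⟩ := h
  have e := h1 i (by simp; omega)
  have hpos : 1 ≤ f (i + 1, 1) := (hmaps (mem_lDomain.2 (Or.inl (by simp; omega)))).1
  have hlow : (1 : ℤ) ≤ ∑ t ∈ Finset.Icc 1 n, if f (1, t) ≤ f (i + 1, 1) then 1 else 0 := by
    refine le_trans ?_ (Finset.single_le_sum (f := fun t => if f (1, t) ≤ f (i + 1, 1) then
      (1 : ℤ) else 0) (fun t _ => ?_) (Finset.mem_Icc.2 ⟨le_rfl, hn⟩))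
    · rw [hone, if_pos hpos]
    · split_ifs <;> simp
  have hup : (∑ t ∈ Finset.Icc 1 n, if f (1, t) ≤ f (i + 1, 1) then (1 : ℤ) else 0) ≤ n := by
    refine (Finset.sum_le_card_nsmul _ _ 1 fun t _ => ?_).trans (by simp)
    split_ifs <;> simp
  omega

theorem IsInjectiveLShape.fst_mono {m n : ℕ} {f : ℕ × ℕ → ℕ} (h : IsInjectiveLShape m n f)
    (hn : 1 ≤ n) {i j : ℕ} (hi : 1 ≤ i) (hij : i ≤ j) (hj : j ≤ m) : f (i, 1) ≤ f (j, 1) := by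
  induction j, hij using Nat.le_induction with
  | base => exact le_rfl
  | succ j hij ih => exact (ih (by omega)).trans (h.fst_step hn (by omega) (by omega)).1.le

theorem IsInjectiveLShape.snd_mono {m n : ℕ} {f : ℕ × ℕ → ℕ} (h : IsInjectiveLShape m n f)
    (hm : 1 ≤ m) {i j : ℕ} (hi : 1 ≤ i) (hij : i ≤ j) (hj : j ≤ n) : f (1, i) ≤ f (1, j) :=
  h.swap.fst_mono hm hi hij hj

theorem IsInjectiveLShape.fst_eq_add {m n : ℕ} {f : ℕ × ℕ → ℕ}
    (h : IsInjectiveLShape (m + 1) n f) (hm : 1 ≤ m) (hlt : f (1, n) < f (m + 1, 1)) :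
    f (m + 1, 1) = f (m, 1) + n := by
  have e := h.2.2.1.1 m (by simp; omega)
  rw [Finset.sum_congr rfl (g := fun _ => (1 : ℤ))] at e
  · simp at e
    omega
  · intro t ht
    obtain ⟨h1, h2⟩ := Finset.mem_Icc.1 ht
    exact if_pos ((h.snd_mono (by omega) h1 h2 le_rfl).trans hlt.le)

/-- The deleted value exceeds every `f (1, j)`, so it was never counted in the other arm's
equations. -/
theorem IsInjectiveLShape.restrict_fst {m n : ℕ} {f : ℕ × ℕ → ℕ}
    (h : IsInjectiveLShape (m + 1) n f) (hm : 1 ≤ m) (hn : 1 ≤ n)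
    (hlt : f (1, n) < f (m + 1, 1)) : IsInjectiveLShape m n f := by
  have hd : lDomain m n ⊆ lDomain (m + 1) n := by
    intro x
    simp only [mem_lDomain]
    omega
  have hsnd : ∀ j ∈ Finset.Icc 1 (n - 1), (f (1, j + 1) : ℤ) - f (1, j) =
      ∑ s ∈ Finset.Icc 1 m, if f (s, 1) ≤ f (1, j + 1) then 1 else 0 := by
    intro j hj
    obtain ⟨hj1, hj2⟩ := Finset.mem_Icc.1 hj
    rw [h.2.2.1.2 j hj, Finset.sum_Icc_succ_top (by omega), if_neg, add_zero]
    exact not_le.2 ((h.snd_mono (by omega) (by omega) (by omega) le_rfl).trans_lt hlt)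
  -- The codomain shrinks to `[m * n]`, so the arm that is kept needs a new bound: its increments
  -- are now at most `m`.
  have hbound : ∀ j, 1 ≤ j → j ≤ n → f (1, j) ≤ 1 + (j - 1) * m := by
    intro j hj
    induction j, hj using Nat.le_induction with
    | base => simp [h.2.2.2]
    | succ j hj ih =>
      intro hjn
      have e := hsnd j (by simp; omega)
      have hup : (∑ s ∈ Finset.Icc 1 m, if f (s, 1) ≤ f (1, j + 1) then (1 : ℤ) else 0) ≤ m := by
        refine (Finset.sum_le_card_nsmul _ _ 1 fun t _ => ?_).trans (by simp)
        split_ifs <;> simp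
      have ih := ih (by omega)
      obtain ⟨j, rfl⟩ := Nat.exists_eq_add_of_le' hj
      simp only [Nat.add_sub_cancel] at ih ⊢
      have : f (1, j + 1 + 1) ≤ f (1, j + 1) + m := by omega
      nlinarith
  refine ⟨fun x hx => ⟨(h.1 (hd hx)).1, ?_⟩, h.2.1.mono hd, ⟨fun i hi => ?_, hsnd⟩, h.2.2.2⟩
  · obtain ⟨i, j⟩ := x
    rcases mem_lDomain.1 hx with ⟨h1, h2, rfl⟩ | ⟨rfl, h1, h2⟩
    · have e := h.fst_eq_add hm hlt
      have hb := (h.1 (x := (m + 1, 1)) (mem_lDomain.2 (Or.inl (by simp)))).2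
      have := h.fst_mono hn h1 h2 (by omega)
      rw [e] at hb
      simp only at h1 h2
      nlinarith
    · simp only at h1 h2
      refine (hbound j h1 h2).trans ?_
      obtain ⟨j, rfl⟩ := Nat.exists_eq_add_of_le' h1
      simp only [Nat.add_sub_cancel]
      nlinarith
  · refine h.2.2.1.1 i ?_
    simp only [Finset.mem_Icc] at hi ⊢
    omega

/-- The appended value is larger than all the others, so injectivity and the old equations survive,
and its own increment counts all of `[n]`. -/
theorem IsInjectiveLShape.extend_fst {m n : ℕ} {f : ℕ × ℕ → ℕ} (h : IsInjectiveLShape m n f)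
    (hm : 1 ≤ m) (hn : 1 ≤ n) (hlt : f (1, n) < f (m, 1) + n) :
    IsInjectiveLShape (m + 1) n (Function.update f (m + 1, 1) (f (m, 1) + n)) := by
  set g := Function.update f (m + 1, 1) (f (m, 1) + n) with hg
  have gtop : g (m + 1, 1) = f (m, 1) + n := Function.update_self _ _ _
  have gfst : ∀ i ≤ m, g (i, 1) = f (i, 1) := fun i hi =>
    Function.update_of_ne (by simp; omega) _ _
  have gsnd : ∀ j, g (1, j) = f (1, j) := fun j => Function.update_of_ne (by simp; omega) _ _
  have hd : ∀ x ∈ lDomain (m + 1) n, x = (m + 1, 1) ∨ x ∈ lDomain m n ∧ g x = f x := by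
    rintro ⟨i, j⟩ hx
    rcases mem_lDomain.1 hx with ⟨h1, h2, rfl⟩ | ⟨rfl, h1, h2⟩
    · simp only at h1 h2
      rcases h2.lt_or_eq with h3 | rfl
      · exact Or.inr ⟨mem_lDomain.2 (Or.inl (by simp; omega)), gfst i (by omega)⟩
      · exact Or.inl rfl
    · exact Or.inr ⟨mem_lDomain.2 (Or.inr ⟨rfl, h1, h2⟩), gsnd j⟩
  have hmax : ∀ x ∈ lDomain m n, f x < f (m, 1) + n := by
    rintro ⟨i, j⟩ hx
    rcases mem_lDomain.1 hx with ⟨h1, h2, rfl⟩ | ⟨rfl, h1, h2⟩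
    · have := h.fst_mono hn h1 h2 le_rfl
      simp only at this
      omega
    · exact (h.snd_mono hm h1 h2 le_rfl).trans_lt hlt
  refine ⟨fun x hx => ?_, fun x hx y hy e => ?_, ⟨fun i hi => ?_, fun j hj => ?_⟩, ?_⟩
  · rcases hd x hx with rfl | ⟨hx, e⟩
    · have := (h.1 (x := (m, 1)) (mem_lDomain.2 (Or.inl (by simp; omega)))).2
      rw [gtop]
      exact ⟨by omega, by nlinarith⟩
    · rw [e]
      have := h.1 hx
      exact ⟨this.1, this.2.trans (Nat.mul_le_mul (by omega) le_rfl)⟩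
  · rcases hd x hx with rfl | ⟨hx, ex⟩ <;> rcases hd y hy with rfl | ⟨hy, ey⟩
    · rfl
    · rw [gtop, ey] at e
      exact absurd e (hmax y hy).ne'
    · rw [gtop, ex] at e
      exact absurd e (hmax x hx).ne
    · rw [ex, ey] at e
      exact h.2.1 hx hy e
  · obtain ⟨hi1, hi2⟩ := Finset.mem_Icc.1 hi
    simp only [gsnd]
    rcases (show i ≤ m by omega).lt_or_eq with hlt' | rfl
    · rw [gfst i (by omega), gfst (i + 1) (by omega)]
      exact h.2.2.1.1 i (by simp; omega)
    · rw [gfst i le_rfl, gtop, Finset.sum_congr rfl (g := fun _ => (1 : ℤ))]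
      · simp
      · intro t ht
        obtain ⟨h1, h2⟩ := Finset.mem_Icc.1 ht
        exact if_pos ((h.snd_mono hm h1 h2 le_rfl).trans hlt.le)
  · obtain ⟨hj1, hj2⟩ := Finset.mem_Icc.1 hj
    rw [gsnd, gsnd, h.2.2.1.2 j hj, Finset.sum_Icc_succ_top (by omega), gtop, if_neg, add_zero]
    · refine Finset.sum_congr rfl fun s hs => ?_
      rw [gfst s (Finset.mem_Icc.1 hs).2]
    · exact not_le.2 ((h.snd_mono hm (by omega) (by omega) le_rfl).trans_lt hlt)
  · rw [gsnd]
    exact h.2.2.2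

/-! ### Children and parents of terminal pairs -/

theorem terminalPairs_swap {m n s t : ℕ} (h : (s, t, (m, n)) ∈ terminalPairs m n) :
    (t, s, (n, m)) ∈ terminalPairs n m := by
  obtain ⟨f, hf, e⟩ := h
  simp only [Prod.mk.injEq] at e
  refine ⟨_, hf.swap, ?_⟩
  simp [e.1, e.2.1]

theorem terminalPairs_child_fst {m n s t : ℕ} (hm : 1 ≤ m) (hn : 1 ≤ n)
    (h : (s, t, (m, n)) ∈ terminalPairs m n) (hlt : t < s + n) :
    (s + n, t, (m + 1, n)) ∈ terminalPairs (m + 1) n := by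
  obtain ⟨f, hf, e⟩ := h
  simp only [Prod.mk.injEq] at e
  obtain ⟨rfl, rfl, -⟩ := e
  refine ⟨_, hf.extend_fst hm hn hlt, ?_⟩
  rw [Function.update_self, Function.update_of_ne (by simp; omega)]

theorem terminalPairs_child_snd {m n s t : ℕ} (hm : 1 ≤ m) (hn : 1 ≤ n)
    (h : (s, t, (m, n)) ∈ terminalPairs m n) (hlt : s < t + m) :
    (s, t + m, (m, n + 1)) ∈ terminalPairs m (n + 1) :=
  terminalPairs_swap (terminalPairs_child_fst hn hm (terminalPairs_swap h) hlt)

theorem terminalPairs_parent_fst {m n s t : ℕ} (hm : 1 ≤ m) (hn : 1 ≤ n)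
    (h : (s, t, (m, n)) ∈ terminalPairs m n) (hlt : t < s) :
    ∃ m' s', m = m' + 1 ∧ 1 ≤ m' ∧ s = s' + n ∧ (s', t, (m', n)) ∈ terminalPairs m' n := by
  obtain ⟨f, hf, e⟩ := h
  simp only [Prod.mk.injEq] at e
  obtain ⟨rfl, rfl, -⟩ := e
  obtain ⟨m, rfl⟩ := Nat.exists_eq_add_of_le' hm
  have hm' : 1 ≤ m := by
    -- If the horizontal arm were the single point `(1, 1)`, then `s = f (1, 1) ≤ t`.
    by_contra! h0
    obtain rfl : m = 0 := by omega
    have := hf.snd_mono le_rfl le_rfl hn le_rfl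
    simp only [zero_add] at hlt
    omega
  exact ⟨m, f (m, 1), rfl, hm', hf.fst_eq_add hm' hlt, f, hf.restrict_fst hm' hn hlt, rfl⟩

theorem terminalPairs_parent_snd {m n s t : ℕ} (hm : 1 ≤ m) (hn : 1 ≤ n)
    (h : (s, t, (m, n)) ∈ terminalPairs m n) (hlt : s < t) :
    ∃ n' t', n = n' + 1 ∧ 1 ≤ n' ∧ t = t' + m ∧ (s, t', (m, n')) ∈ terminalPairs m n' := by
  obtain ⟨n', t', e, hn', et, h'⟩ := terminalPairs_parent_fst hn hm (terminalPairs_swap h) hlt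
  exact ⟨n', t', e, hn', et, terminalPairs_swap h'⟩

theorem terminalPairs_ne {m n s t : ℕ} (hm : 1 ≤ m) (hn : 1 ≤ n) (hmn : 3 ≤ m + n)
    (h : (s, t, (m, n)) ∈ terminalPairs m n) : s ≠ t := by
  obtain ⟨f, hf, e⟩ := h
  simp only [Prod.mk.injEq] at e
  obtain ⟨rfl, rfl, -⟩ := e
  intro e
  have := hf.2.1 (mem_lDomain.2 (Or.inl (by simp; omega))) (mem_lDomain.2 (Or.inr (by simp; omega)))
    e
  simp at this
  omega

theorem mem_terminalLevel {k s t m n : ℕ} : (s, t, (m, n)) ∈ terminalLevel k ↔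
    1 ≤ m ∧ 1 ≤ n ∧ m + n = k ∧ (s, t, (m, n)) ∈ terminalPairs m n := by
  constructor
  · rintro ⟨m', n', hm, hn, hk, h⟩
    obtain ⟨rfl, rfl⟩ : m = m' ∧ n = n' := by
      obtain ⟨f, -, e⟩ := h
      simp only [Prod.mk.injEq] at e
      exact e.2.2
    exact ⟨hm, hn, hk, h⟩
  · rintro ⟨hm, hn, hk, h⟩
    exact ⟨m, n, hm, hn, hk, h⟩

theorem mem_terminalLevel_of_childRule {k : ℕ} {v w : TaggedPair} (hv : v ∈ terminalLevel k)
    (h : ChildRule v w) : w ∈ terminalLevel (k + 1) ∧ terminalParent w = v := by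
  obtain ⟨s, t, m, n⟩ := v
  obtain ⟨hm, hn, hk, hv⟩ := mem_terminalLevel.1 hv
  rcases h with ⟨h, rfl⟩ | ⟨h, rfl⟩
  · refine ⟨mem_terminalLevel.2
      ⟨by omega, hn, by omega, terminalPairs_child_fst hm hn hv (by omega)⟩, ?_⟩
    simp only [terminalParent]
    rw [if_pos (by omega)]
    simp
  · refine ⟨mem_terminalLevel.2
      ⟨hm, by omega, by omega, terminalPairs_child_snd hm hn hv (by omega)⟩, ?_⟩
    simp only [terminalParent]
    rw [if_neg (by omega)]
    simp

theorem terminalParent_mem_of_mem {k : ℕ} {w : TaggedPair} (hk : 2 ≤ k)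
    (hw : w ∈ terminalLevel (k + 1)) :
    terminalParent w ∈ terminalLevel k ∧ ChildRule (terminalParent w) w := by
  obtain ⟨s, t, m, n⟩ := w
  obtain ⟨hm, hn, hmn, hw⟩ := mem_terminalLevel.1 hw
  rcases lt_or_gt_of_ne (terminalPairs_ne hm hn (by omega) hw) with hlt | hlt
  · obtain ⟨n, t, rfl, hn', rfl, h⟩ := terminalPairs_parent_snd hm hn hw hlt
    simp only [terminalParent, if_neg hlt.not_gt, Nat.add_sub_cancel]
    exact ⟨mem_terminalLevel.2 ⟨hm, hn', by omega, h⟩, Or.inr ⟨by omega, rfl⟩⟩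
  · obtain ⟨m, s, rfl, hm', rfl, h⟩ := terminalPairs_parent_fst hm hn hw hlt
    simp only [terminalParent, if_pos hlt, Nat.add_sub_cancel]
    exact ⟨mem_terminalLevel.2 ⟨hm', hn, by omega, h⟩, Or.inl ⟨by omega, rfl⟩⟩

theorem childRule_iff {k : ℕ} {v w : TaggedPair} (hk : 2 ≤ k) (hv : v ∈ terminalLevel k) :
    (w ∈ terminalLevel (k + 1) ∧ terminalParent w = v) ↔ ChildRule v w := by
  refine ⟨?_, mem_terminalLevel_of_childRule hv⟩
  rintro ⟨hw, rfl⟩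
  exact (terminalParent_mem_of_mem hk hw).2

theorem terminalLevel_succ (k : ℕ) :
    terminalLevel (k + 3) = {w | ∃ v ∈ terminalLevel (k + 2), ChildRule v w} := by
  ext w
  constructor
  · intro hw
    obtain ⟨h1, h2⟩ := terminalParent_mem_of_mem (by omega) hw
    exact ⟨_, h1, h2⟩
  · rintro ⟨v, hv, h⟩
    exact (mem_terminalLevel_of_childRule hv h).1

theorem terminalLevel_two : terminalLevel 2 = {(1, 1, (1, 1))} := by
  ext ⟨s, t, m, n⟩
  constructor
  · intro h
    obtain ⟨hm, hn, hmn, f, hf, e⟩ := mem_terminalLevel.1 h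
    obtain ⟨rfl, rfl⟩ : m = 1 ∧ n = 1 := by omega
    rw [e, hf.2.2.2]
    rfl
  · intro h
    rw [Set.mem_singleton_iff] at h
    rw [h]
    exact terminalRoot_mem

theorem terminalParent_mapsTo (k : ℕ) :
    Set.MapsTo terminalParent (terminalLevel (k + 3)) (terminalLevel (k + 2)) :=
  fun _ hw => (terminalParent_mem_of_mem (by omega) hw).1

theorem terminalParent_surjOn (k : ℕ) :
    Set.SurjOn terminalParent (terminalLevel (k + 3)) (terminalLevel (k + 2)) := by
  rintro ⟨s, t, m, n⟩ hv
  obtain ⟨hm, hn, -⟩ := mem_terminalLevel.1 hv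
  have : ∃ w, ChildRule (s, t, (m, n)) w := by
    -- At least one child exists: `s - t ≤ -n` implies `s - t < m`.
    by_cases h : (s : ℤ) - t > -n
    · exact ⟨_, Or.inl ⟨h, rfl⟩⟩
    · exact ⟨_, Or.inr ⟨by omega, rfl⟩⟩
  obtain ⟨w, hw⟩ := this
  exact ⟨w, mem_terminalLevel_of_childRule hv hw⟩

theorem youngLevel_eq_terminalLevel (k : ℕ) : youngLevel (k + 2) = terminalLevel (k + 2) := by
  induction k with
  | zero => rw [youngLevel_two, terminalLevel_two]
  | succ k ih => rw [youngLevel_succ, terminalLevel_succ, ih]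

/-! ## Intervals of generalized Farey fractions -/

theorem mem_fractions {m n : ℕ} {c : EReal} : c ∈ fractions m n ↔ c = 0 ∨ c = ⊤ ∨
    ∃ p q : ℕ, 1 ≤ p ∧ p ≤ m ∧ 1 ≤ q ∧ q ≤ n ∧ c = (((p : ℝ) / q : ℝ) : EReal) := by
  simp only [fractions, Set.mem_union, Set.mem_insert_iff, Set.mem_singleton_iff, or_assoc]
  refine or_congr_right (or_congr_right ⟨?_, ?_⟩)
  · rintro ⟨p, hp, q, hq, h⟩
    rw [Finset.mem_Icc] at hp hq
    exact ⟨p, q, hp.1, hp.2, hq.1, hq.2, h⟩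
  · rintro ⟨p, q, h1, h2, h3, h4, h⟩
    exact ⟨p, Finset.mem_Icc.2 ⟨h1, h2⟩, q, Finset.mem_Icc.2 ⟨h3, h4⟩, h⟩

theorem zero_mem_fractions (m n : ℕ) : 0 ∈ fractions m n := mem_fractions.2 (Or.inl rfl)

theorem top_mem_fractions (m n : ℕ) : ⊤ ∈ fractions m n := mem_fractions.2 (Or.inr (Or.inl rfl))

theorem coe_div_mem_fractions {m n p q : ℕ} (hp : 1 ≤ p) (hpm : p ≤ m) (hq : 1 ≤ q) (hqn : q ≤ n) :
    (((p : ℝ) / q : ℝ) : EReal) ∈ fractions m n :=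
  mem_fractions.2 (Or.inr (Or.inr ⟨p, q, hp, hpm, hq, hqn, rfl⟩))

theorem fractions_mono {m n m' n' : ℕ} (hm : m ≤ m') (hn : n ≤ n') :
    fractions m n ⊆ fractions m' n' := by
  intro c hc
  rcases mem_fractions.1 hc with rfl | rfl | ⟨p, q, h1, h2, h3, h4, rfl⟩
  · exact zero_mem_fractions _ _
  · exact top_mem_fractions _ _
  · exact coe_div_mem_fractions h1 (h2.trans hm) h3 (h4.trans hn)

theorem nonneg_of_mem_fractions {m n : ℕ} {c : EReal} (h : c ∈ fractions m n) : 0 ≤ c := by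
  rcases mem_fractions.1 h with rfl | rfl | ⟨p, q, h1, h2, h3, h4, rfl⟩
  · exact le_rfl
  · exact le_top
  · exact_mod_cast div_nonneg (Nat.cast_nonneg p) (Nat.cast_nonneg q)

theorem finite_fractions (m n : ℕ) : (fractions m n).Finite := by
  refine Set.Finite.subset (((Set.finite_singleton ⊤).insert 0).union
    (((Finset.Icc 1 m ×ˢ Finset.Icc 1 n).finite_toSet).image
      fun x : ℕ × ℕ => (((x.1 : ℝ) / x.2 : ℝ) : EReal))) ?_
  intro c hc
  rcases mem_fractions.1 hc with rfl | rfl | ⟨p, q, h1, h2, h3, h4, rfl⟩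
  · simp
  · simp
  · exact Or.inr ⟨(p, q), by simp; omega, rfl⟩

theorem coe_div_lt_coe_iff {p q : ℕ} {ξ : ℝ} (hq : 1 ≤ q) :
    (((p : ℝ) / q : ℝ) : EReal) < ξ ↔ p < ξ * q := by
  rw [EReal.coe_lt_coe_iff, div_lt_iff₀ (by exact_mod_cast hq)]

theorem coe_lt_coe_div_iff {p q : ℕ} {ξ : ℝ} (hq : 1 ≤ q) :
    (ξ : EReal) < (((p : ℝ) / q : ℝ) : EReal) ↔ ξ * q < p := by
  rw [EReal.coe_lt_coe_iff, lt_div_iff₀ (by exact_mod_cast hq)]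

theorem IsInterval.le_or_le {m n : ℕ} {a b c : EReal} (h : IsInterval m n a b)
    (hc : c ∈ fractions m n) : c ≤ a ∨ b ≤ c := by
  by_contra! hlt
  exact h.2.2.2 c hc hlt

theorem IsInterval.pos {m n : ℕ} {a b : EReal} (h : IsInterval m n a b) {ξ : ℝ}
    (ha : a < ξ) : 0 < ξ := by
  exact_mod_cast (nonneg_of_mem_fractions h.1).trans_lt ha

theorem IsInterval.generic {m n : ℕ} {a b : EReal} (h : IsInterval m n a b) {ξ : ℝ}
    (ha : a < ξ) (hb : ξ < b) : Generic m n ξ := by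
  intro p q hp hpm hq hqn e
  refine h.2.2.2 ξ ?_ ⟨ha, hb⟩
  have hq' : (0 : ℝ) < q := by exact_mod_cast hq
  rw [show ξ = (p : ℝ) / q by rw [← e]; field_simp]
  exact coe_div_mem_fractions hp hpm hq hqn

theorem IsInterval.sameSide {m n : ℕ} {a b : EReal} (h : IsInterval m n a b) {ξ η : ℝ}
    (ha : a < ξ) (hb : ξ < b) (ha' : a < η) (hb' : η < b) : SameSide m n ξ η := by
  intro p q hp hpm hq hqn
  rw [← coe_lt_coe_div_iff hq, ← coe_lt_coe_div_iff hq]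
  rcases h.le_or_le (coe_div_mem_fractions hp hpm hq hqn) with hc | hc
  · exact iff_of_false (hc.trans ha.le).not_gt (hc.trans ha'.le).not_gt
  · exact iff_of_true (hb.trans_le hc) (hb'.trans_le hc)

theorem SameSide.lt_iff_of_mem_fractions {m n : ℕ} {ξ η : ℝ} (hξ : 0 < ξ) (hη : 0 < η)
    (h : SameSide m n ξ η) {c : EReal} (hc : c ∈ fractions m n) :
    (ξ : EReal) < c ↔ (η : EReal) < c := by
  rcases mem_fractions.1 hc with rfl | rfl | ⟨p, q, h1, h2, h3, h4, rfl⟩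
  · exact iff_of_false (by exact_mod_cast hξ.not_gt) (by exact_mod_cast hη.not_gt)
  · exact iff_of_true (EReal.coe_lt_top _) (EReal.coe_lt_top _)
  · rw [coe_lt_coe_div_iff h3, coe_lt_coe_div_iff h3]
    exact h p q h1 h2 h3 h4

/-- Each end point is itself a fraction, so it has the same position relative to `ξ` and to `η`;
this leaves no room for the two intervals to differ. -/
theorem IsInterval.eq_of_sameSide {m n : ℕ} {a b a' b' : EReal} (h : IsInterval m n a b)
    (h' : IsInterval m n a' b') {ξ η : ℝ} (ha : a < ξ) (hb : ξ < b) (ha' : a' < η) (hb' : η < b')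
    (hs : SameSide m n ξ η) : a = a' ∧ b = b' := by
  have hlt : ∀ c ∈ fractions m n, (ξ : EReal) < c ↔ (η : EReal) < c := fun c hc =>
    hs.lt_iff_of_mem_fractions (h.pos ha) (h'.pos ha') hc
  have h1 : a ≤ a' := (h'.le_or_le h.1).resolve_right fun hle =>
    ((hlt a h.1).2 (hb'.trans_le hle)).asymm ha
  have h2 : a' ≤ a := (h.le_or_le h'.1).resolve_right fun hle =>
    ((hlt a' h'.1).1 (hb.trans_le hle)).asymm ha'
  have h3 : b ≤ b' := (h.le_or_le h'.2.1).resolve_left fun hle =>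
    ((hlt b' h'.2.1).2 hb').not_ge (hle.trans ha.le)
  have h4 : b' ≤ b := (h'.le_or_le h.2.1).resolve_left fun hle =>
    ((hlt b h.2.1).1 hb).not_ge (hle.trans ha'.le)
  exact ⟨le_antisymm h1 h2, le_antisymm h3 h4⟩

theorem isInterval_sInf {m n : ℕ} {a : EReal} (ha : a ∈ fractions m n) (htop : a < ⊤) :
    IsInterval m n a (sInf {c | c ∈ fractions m n ∧ a < c}) := by
  have hmem : sInf {c | c ∈ fractions m n ∧ a < c} ∈ {c | c ∈ fractions m n ∧ a < c} :=
    Set.Nonempty.csInf_mem ⟨⊤, top_mem_fractions m n, htop⟩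
      ((finite_fractions m n).subset fun c hc => hc.1)
  exact ⟨ha, hmem.1, hmem.2, fun c hc hlt => hlt.2.not_ge (sInf_le ⟨hc, hlt.1⟩)⟩

theorem isInterval_sSup {m n : ℕ} {b : EReal} (hb : b ∈ fractions m n) (hpos : 0 < b) :
    IsInterval m n (sSup {c | c ∈ fractions m n ∧ c < b}) b := by
  have hmem : sSup {c | c ∈ fractions m n ∧ c < b} ∈ {c | c ∈ fractions m n ∧ c < b} :=
    Set.Nonempty.csSup_mem ⟨0, zero_mem_fractions m n, hpos⟩
      ((finite_fractions m n).subset fun c hc => hc.1)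
  exact ⟨hmem.1, hb, hmem.2, fun c hc hlt => hlt.1.not_ge (le_sSup ⟨hc, hlt.2⟩)⟩

/-- Take the largest fraction below `ξ` and its successor. -/
theorem exists_isInterval {m n : ℕ} {ξ : ℝ} (hξ : 0 < ξ) (g : Generic m n ξ) :
    ∃ a b, IsInterval m n a b ∧ a < ξ ∧ ξ < b := by
  have hne : (ξ : EReal) ∉ fractions m n := by
    intro hc
    rcases mem_fractions.1 hc with h | h | ⟨p, q, h1, h2, h3, h4, h⟩
    · exact hξ.ne' (by exact_mod_cast h)
    · exact EReal.coe_ne_top ξ h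
    · refine g p q h1 h2 h3 h4 ?_
      have hq' : (0 : ℝ) < q := by exact_mod_cast h3
      rw [EReal.coe_eq_coe_iff.1 h]
      field_simp
  have hmem : sSup {c | c ∈ fractions m n ∧ c < ξ} ∈ {c | c ∈ fractions m n ∧ c < (ξ : EReal)} :=
    Set.Nonempty.csSup_mem ⟨0, zero_mem_fractions m n, by exact_mod_cast hξ⟩
      ((finite_fractions m n).subset fun c hc => hc.1)
  have hI := isInterval_sInf hmem.1 (hmem.2.trans (EReal.coe_lt_top ξ))
  refine ⟨_, _, hI, hmem.2, ?_⟩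
  by_contra! hle
  have hlt := lt_of_le_of_ne hle fun e => hne (e ▸ hI.2.1)
  exact hI.2.2.1.not_ge (le_sSup ⟨hI.2.1, hlt⟩)

/-- Fractions with numerator `m + 1` are at least `(m + 1) / n`. -/
theorem mem_fractions_of_lt {m n : ℕ} {c : EReal} (hc : c ∈ fractions (m + 1) n)
    (hlt : c < ((((m + 1 : ℕ) : ℝ) / (n : ℝ) : ℝ) : EReal)) : c ∈ fractions m n := by
  rcases mem_fractions.1 hc with rfl | rfl | ⟨p, q, h1, h2, h3, h4, rfl⟩
  · exact zero_mem_fractions _ _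
  · exact top_mem_fractions _ _
  · refine coe_div_mem_fractions h1 ?_ h3 h4
    by_contra! h
    obtain rfl : p = m + 1 := by omega
    rw [EReal.coe_lt_coe_iff] at hlt
    refine hlt.not_ge (div_le_div_of_nonneg_left (Nat.cast_nonneg _) (by exact_mod_cast h3) ?_)
    exact_mod_cast h4

theorem mem_fractions_of_gt {m n : ℕ} {c : EReal} (hc : c ∈ fractions m (n + 1))
    (hlt : (((m : ℝ) / ((n + 1 : ℕ) : ℝ) : ℝ) : EReal) < c) : c ∈ fractions m n := by
  rcases mem_fractions.1 hc with rfl | rfl | ⟨p, q, h1, h2, h3, h4, rfl⟩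
  · exact zero_mem_fractions _ _
  · exact top_mem_fractions _ _
  · refine coe_div_mem_fractions h1 h2 h3 ?_
    by_contra! h
    obtain rfl : q = n + 1 := by omega
    rw [EReal.coe_lt_coe_iff] at hlt
    refine hlt.not_ge (div_le_div_of_nonneg_right ?_ (Nat.cast_nonneg _))
    exact_mod_cast h2

theorem IsInterval.eq_zero_top {m n : ℕ} {a b : EReal} (h : IsInterval m n a b)
    (hmn : m = 0 ∨ n = 0) : a = 0 ∧ b = ⊤ := by
  have hF : ∀ c ∈ fractions m n, c = 0 ∨ c = ⊤ := by
    intro c hc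
    rcases mem_fractions.1 hc with h | h | ⟨p, q, h1, h2, h3, h4, -⟩
    · exact Or.inl h
    · exact Or.inr h
    · omega
  have hlt := h.2.2.1
  rcases hF a h.1 with rfl | rfl <;> rcases hF b h.2.1 with rfl | rfl
  · exact absurd hlt (lt_irrefl _)
  · exact ⟨rfl, rfl⟩
  · exact absurd hlt not_top_lt
  · exact absurd hlt (lt_irrefl _)

theorem isInterval_zero_top {m n : ℕ} (hmn : m = 0 ∨ n = 0) : IsInterval m n 0 ⊤ := by
  refine ⟨zero_mem_fractions m n, top_mem_fractions m n, EReal.zero_lt_top, fun c hc hlt => ?_⟩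
  rcases mem_fractions.1 hc with rfl | rfl | ⟨p, q, h1, h2, h3, h4, -⟩
  · exact lt_irrefl _ hlt.1
  · exact lt_irrefl _ hlt.2
  · omega

/-- The parent of an interval is an interval containing it, and its index is found by comparing the
interval with the corner fraction. -/
theorem fareyParent_spec {m n k : ℕ} {a b : EReal} (h : IsInterval m n a b) (hk : m + n = k + 1) :
    (∃ m' c d, m = m' + 1 ∧ fareyParent ((a, b), (m, n)) = ((c, d), (m', n)) ∧
      IsInterval m' n c d ∧ c ≤ a ∧ b ≤ d ∧ ∀ ξ : ℝ, (ξ : EReal) < b → ξ * n < m) ∨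
    (∃ n' c d, n = n' + 1 ∧ fareyParent ((a, b), (m, n)) = ((c, d), (m, n')) ∧
      IsInterval m n' c d ∧ c ≤ a ∧ b ≤ d ∧ ∀ ξ : ℝ, a < (ξ : EReal) → m < ξ * n) := by
  rcases m with _ | m
  · obtain rfl : n = k + 1 := by omega
    obtain ⟨rfl, rfl⟩ := h.eq_zero_top (Or.inl rfl)
    refine Or.inr ⟨k, 0, ⊤, rfl, rfl, isInterval_zero_top (Or.inl rfl), le_rfl, le_rfl, ?_⟩
    intro ξ hξ
    have : (0 : ℝ) < ξ := by exact_mod_cast hξ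
    push_cast
    positivity
  rcases n with _ | n
  · obtain ⟨rfl, rfl⟩ := h.eq_zero_top (Or.inr rfl)
    refine Or.inl ⟨m, 0, ⊤, rfl, rfl, isInterval_zero_top (Or.inr rfl), le_rfl, le_rfl, ?_⟩
    intro ξ _
    push_cast
    rw [mul_zero]
    positivity
  set r : EReal := ((((m + 1 : ℕ) : ℝ) / ((n + 1 : ℕ) : ℝ) : ℝ) : EReal) with hr
  have hrF : r ∈ fractions (m + 1) (n + 1) :=
    coe_div_mem_fractions (by omega) le_rfl (by omega) le_rfl
  have hab := h.2.2.1
  have hpar : fareyParent ((a, b), (m + 1, n + 1)) =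
      if b < r then ((a, b), (m, n + 1))
      else if b = r then ((a, sInf {c | c ∈ fractions m (n + 1) ∧ a < c}), (m, n + 1))
      else if a = r then ((sSup {c | c ∈ fractions (m + 1) n ∧ c < b}, b), (m + 1, n))
      else ((a, b), (m + 1, n)) := rfl
  -- The corner `r` is a fraction of this index, so it is not interior to the interval: either `b ≤
  -- r` or `r ≤ a`.
  by_cases hbr : b ≤ r
  · left
    have haF : a ∈ fractions m (n + 1) := mem_fractions_of_lt h.1 (hab.trans_le hbr)
    have hξ : ∀ ξ : ℝ, (ξ : EReal) < b → ξ * (n + 1 : ℕ) < (m + 1 : ℕ) := fun ξ hξ =>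
      (coe_lt_coe_div_iff (by omega)).1 (hξ.trans_le hbr)
    rcases hbr.lt_or_eq with hlt | heq
    · refine ⟨m, a, b, rfl, by rw [hpar, if_pos hlt], ⟨haF, mem_fractions_of_lt h.2.1 hlt,
        hab, fun c hc => h.2.2.2 c (fractions_mono (by omega) le_rfl hc)⟩, le_rfl, le_rfl, hξ⟩
    · have hI := isInterval_sInf haF (hab.trans_le le_top)
      refine ⟨m, a, _, rfl, by rw [hpar, if_neg heq.not_lt, if_pos heq], hI, le_rfl, ?_, hξ⟩
      -- The successor of `a` among fewer fractions cannot come before `b`.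
      exact (h.le_or_le (fractions_mono (by omega) le_rfl hI.2.1)).resolve_left hI.2.2.1.not_ge
  · right
    have hra : r ≤ a := (h.le_or_le hrF).resolve_right hbr
    have hrb : r < b := not_le.1 hbr
    have hbF : b ∈ fractions (m + 1) n := mem_fractions_of_gt h.2.1 hrb
    have hξ : ∀ ξ : ℝ, a < (ξ : EReal) → (m + 1 : ℕ) < ξ * (n + 1 : ℕ) := fun ξ hξ =>
      (coe_div_lt_coe_iff (by omega)).1 (hra.trans_lt hξ)
    rw [hpar, if_neg hrb.not_gt, if_neg hrb.ne']
    rcases hra.lt_or_eq with hlt | heq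
    · refine ⟨n, a, b, rfl, if_neg hlt.ne', ⟨mem_fractions_of_gt h.1 hlt, hbF, hab,
        fun c hc => h.2.2.2 c (fractions_mono le_rfl (by omega) hc)⟩, le_rfl, le_rfl, hξ⟩
    · have hI := isInterval_sSup hbF ((nonneg_of_mem_fractions h.1).trans_lt hab)
      refine ⟨n, _, b, rfl, if_pos heq.symm, hI, ?_, le_rfl, hξ⟩
      exact (h.le_or_le (fractions_mono le_rfl (by omega) hI.1)).resolve_right hI.2.2.1.not_ge

/-! ### Levels of Farey intervals and Surányi's map -/

theorem mem_fareyLevel {k m n : ℕ} {a b : EReal} :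
    ((a, b), (m, n)) ∈ fareyLevel k ↔ m + n = k ∧ IsInterval m n a b := by
  constructor
  · rintro ⟨m', n', hk, hI, e⟩
    simp only [Prod.mk.injEq] at e hI
    obtain ⟨rfl, rfl⟩ := e
    exact ⟨hk, hI⟩
  · rintro ⟨hk, hI⟩
    exact ⟨m, n, hk, hI, rfl⟩

theorem fareyLevel_zero : fareyLevel 0 = {((0, ⊤), (0, 0))} := by
  ext ⟨⟨a, b⟩, m, n⟩
  constructor
  · intro h
    obtain ⟨hk, hI⟩ := mem_fareyLevel.1 h
    obtain ⟨rfl, rfl⟩ : m = 0 ∧ n = 0 := by omega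
    obtain ⟨rfl, rfl⟩ := hI.eq_zero_top (Or.inl rfl)
    rfl
  · intro h
    rw [Set.mem_singleton_iff] at h
    rw [h]
    exact fareyRoot_mem

theorem fareyParent_mapsTo (k : ℕ) :
    Set.MapsTo fareyParent (fareyLevel (k + 1)) (fareyLevel k) := by
  rintro ⟨⟨a, b⟩, m, n⟩ h
  obtain ⟨hk, hI⟩ := mem_fareyLevel.1 h
  rcases fareyParent_spec hI hk with ⟨m', c, d, rfl, e, hI', -⟩ | ⟨n', c, d, rfl, e, hI', -⟩
  · rw [e]
    exact mem_fareyLevel.2 ⟨by omega, hI'⟩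
  · rw [e]
    exact mem_fareyLevel.2 ⟨by omega, hI'⟩

theorem IsInterval.rankingPair_eq {m n : ℕ} {a b : EReal} (h : IsInterval m n a b) {ξ η : ℝ}
    (ha : a < ξ) (hb : ξ < b) (ha' : a < η) (hb' : η < b) :
    rankingPair m n ξ = rankingPair m n η :=
  (rankingPair_eq_iff (h.pos ha) (h.pos ha') (h.generic ha hb) (h.generic ha' hb')).2
    (h.sameSide ha hb ha' hb')

theorem IsInterval.suranyi_eq {m n : ℕ} {a b : EReal} (h : IsInterval m n a b) {ξ : ℝ}
    (ha : a < ξ) (hb : ξ < b) : suranyi ((a, b), (m, n)) = rankingPair m n ξ := by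
  have hε := Classical.epsilon_spec
    (p := fun η : ℝ => a < (η : EReal) ∧ (η : EReal) < b) ⟨ξ, ha, hb⟩
  exact h.rankingPair_eq hε.1 hε.2 ha hb

/-- Surányi's map intertwines the inter-level maps. -/
theorem suranyi_fareyParent {k : ℕ} {x : TaggedInterval} (hx : x ∈ fareyLevel (k + 1)) :
    suranyi (fareyParent x) = terminalParent (suranyi x) := by
  obtain ⟨⟨a, b⟩, m, n⟩ := x
  obtain ⟨hk, hI⟩ := mem_fareyLevel.1 hx
  obtain ⟨ξ, ha, hb⟩ := EReal.lt_iff_exists_real_btwn.1 hI.2.2.1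
  have hξ := hI.pos ha
  rw [hI.suranyi_eq ha hb]
  rcases fareyParent_spec hI hk with ⟨m', c, d, rfl, e, hI', hc, hd, hlt⟩ |
    ⟨n', c, d, rfl, e, hI', hc, hd, hlt⟩
  -- The parent interval contains the given one, so the same `ξ` computes both pairs.
  · rw [e, hI'.suranyi_eq (hc.trans_lt ha) (hb.trans_le hd)]
    have hlt := hlt ξ hb
    have hst := rankingPair_snd_lt_fst hlt
    push_cast at hlt
    have e := rankingPair_succ_left hξ hlt
    rw [e] at hst ⊢
    simp only [terminalParent, if_pos hst, Nat.add_sub_cancel]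
    rfl
  · rw [e, hI'.suranyi_eq (hc.trans_lt ha) (hb.trans_le hd)]
    have hlt := hlt ξ ha
    have hst := rankingPair_fst_lt_snd hlt
    push_cast at hlt
    have e := rankingPair_succ_right hξ hlt
    rw [e] at hst ⊢
    simp only [terminalParent, if_neg hst.not_gt, Nat.add_sub_cancel]
    rfl

theorem suranyi_bijOn (k : ℕ) : Set.BijOn suranyi (fareyLevel k) (youngLevel (k + 2)) := by
  refine ⟨?_, ?_, ?_⟩
  · rintro ⟨⟨a, b⟩, m, n⟩ hx
    obtain ⟨hk, hI⟩ := mem_fareyLevel.1 hx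
    obtain ⟨ξ, ha, hb⟩ := EReal.lt_iff_exists_real_btwn.1 hI.2.2.1
    exact mem_youngLevel_iff.2 ⟨m, n, ξ, hk, hI.pos ha, hI.generic ha hb, hI.suranyi_eq ha hb⟩
  · rintro ⟨⟨a, b⟩, m, n⟩ hx ⟨⟨a', b'⟩, m', n'⟩ hx' e
    obtain ⟨hk, hI⟩ := mem_fareyLevel.1 hx
    obtain ⟨hk', hI'⟩ := mem_fareyLevel.1 hx'
    obtain ⟨ξ, ha, hb⟩ := EReal.lt_iff_exists_real_btwn.1 hI.2.2.1
    obtain ⟨η, ha', hb'⟩ := EReal.lt_iff_exists_real_btwn.1 hI'.2.2.1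
    rw [hI.suranyi_eq ha hb, hI'.suranyi_eq ha' hb'] at e
    obtain ⟨rfl, rfl⟩ : m = m' ∧ n = n' := by
      have := congrArg (fun z : TaggedPair => z.2.2) e
      simpa [rankingPair] using this
    have hs := (rankingPair_eq_iff (hI.pos ha) (hI'.pos ha') (hI.generic ha hb)
      (hI'.generic ha' hb')).1 e
    obtain ⟨rfl, rfl⟩ := hI.eq_of_sameSide hI' ha hb ha' hb' hs
    rfl
  · intro z hz
    obtain ⟨m, n, ξ, hk, hξ, g, rfl⟩ := mem_youngLevel_iff.1 hz
    obtain ⟨a, b, hI, ha, hb⟩ := exists_isInterval hξ g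
    exact ⟨_, mem_fareyLevel.2 ⟨hk, hI⟩, hI.suranyi_eq ha hb⟩

theorem suranyi_bijOn_terminalLevel (k : ℕ) :
    Set.BijOn suranyi (fareyLevel k) (terminalLevel (k + 2)) :=
  youngLevel_eq_terminalLevel k ▸ suranyi_bijOn k

/-- Transported from the terminal pairs, where a child can be written down explicitly. -/
theorem fareyParent_surjOn (k : ℕ) :
    Set.SurjOn fareyParent (fareyLevel (k + 1)) (fareyLevel k) := by
  intro y hy
  obtain ⟨w, hw, hwy⟩ := terminalParent_surjOn k ((suranyi_bijOn_terminalLevel k).mapsTo hy)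
  obtain ⟨x, hx, rfl⟩ := (suranyi_bijOn_terminalLevel (k + 1)).surjOn hw
  refine ⟨x, hx, (suranyi_bijOn k).injOn (fareyParent_mapsTo k hx) hy ?_⟩
  rw [suranyi_fareyParent hx, hwy]

/-! ## Level graphs -/

/-- Iterating `parent` connects every vertex to the single vertex of level 0, and every edge is a
bridge. -/
theorem levelGraph_isTree {α : Type} {level : ℕ → Set α} {parent : α → α} {N : ℕ} {r : α}
    (h0 : level 0 = {r}) (hp : ∀ k < N, Set.MapsTo parent (level (k + 1)) (level k)) :
    (levelGraph level parent N).IsTree := by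
  set G := levelGraph level parent N
  have hr : r ∈ level 0 := by rw [h0]; rfl
  let root : Vertex level N := ⟨0, ⟨r, hr⟩⟩
  have hreach : ∀ k, ∀ x : Vertex level N, (x.1 : ℕ) = k → G.Reachable x root := by
    intro k
    induction k with
    | zero =>
      rintro ⟨⟨i, hi⟩, x, hx⟩ hk
      obtain rfl : i = 0 := hk
      have hx' : x = r := by simpa [h0] using hx
      subst hx'
      exact SimpleGraph.Reachable.refl _
    | succ k ih =>
      rintro ⟨⟨i, hi⟩, x, hx⟩ hk
      obtain rfl : i = k + 1 := hk
      have hadj : G.Adj ⟨⟨k + 1, hi⟩, x, hx⟩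
          ⟨⟨k, by omega⟩, parent x, hp k (by omega) hx⟩ := Or.inr ⟨rfl, rfl⟩
      exact hadj.reachable.trans (ih _ rfl)
  have : Nonempty (Vertex level N) := ⟨root⟩
  refine ⟨SimpleGraph.Connected.mk fun x y => (hreach _ x rfl).trans (hreach _ y rfl).symm, ?_⟩
  rw [SimpleGraph.isAcyclic_iff_forall_adj_isBridge]
  -- Removing the edge above `x` separates the descendants of `x` from the other vertices.
  have hbridge : ∀ x y : Vertex level N, (x.1 : ℕ) = (y.1 : ℕ) + 1 → parent x.2 = y.2 →
      G.IsBridge s(x, y) := by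
    intro x y hxy hpar
    rw [SimpleGraph.isBridge_iff]
    -- `D z` says that `x` is `z` or an ancestor of `z`.
    let D : Vertex level N → Prop := fun z =>
      (x.1 : ℕ) ≤ (z.1 : ℕ) ∧ parent^[(z.1 : ℕ) - (x.1 : ℕ)] z.2 = x.2
    have hchild : ∀ u v : Vertex level N, (v.1 : ℕ) = (u.1 : ℕ) + 1 → parent v.2 = u.2 →
        v ≠ x → (D u ↔ D v) := by
      intro u v huv hpuv hvx
      have hstep : (x.1 : ℕ) ≤ (u.1 : ℕ) →
          parent^[(v.1 : ℕ) - (x.1 : ℕ)] (v.2 : α) = parent^[(u.1 : ℕ) - (x.1 : ℕ)] (u.2 : α) := by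
        intro hle
        rw [show (v.1 : ℕ) - (x.1 : ℕ) = ((u.1 : ℕ) - (x.1 : ℕ)) + 1 by omega,
          Function.iterate_succ_apply, hpuv]
      constructor
      · rintro ⟨h1, h2⟩
        exact ⟨by omega, (hstep h1).trans h2⟩
      · rintro ⟨h1, h2⟩
        rcases h1.lt_or_eq with hlt | heq
        · exact ⟨by omega, (hstep (by omega)).symm.trans h2⟩
        · refine absurd ?_ hvx
          rw [show (v.1 : ℕ) - (x.1 : ℕ) = 0 by omega] at h2
          obtain ⟨i, v, hv⟩ := v
          obtain ⟨j, x, hx⟩ := x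
          obtain rfl : j = i := Fin.ext heq
          obtain rfl : v = x := h2
          rfl
    have hinv : ∀ u v, (G.deleteEdges {s(x, y)}).Reachable u v → (D u ↔ D v) := by
      rintro u v ⟨p⟩
      induction p with
      | nil => exact Iff.rfl
      | cons hadj _ ih =>
        rename_i u v w _
        refine Iff.trans ?_ ih
        rw [SimpleGraph.deleteEdges_adj, Set.mem_singleton_iff] at hadj
        obtain ⟨hadj, hne⟩ := hadj
        -- The removed edge is the only one going from `x` towards the root.
        have huniq : ∀ a b : Vertex level N, (a.1 : ℕ) = (b.1 : ℕ) + 1 → parent a.2 = b.2 →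
            s(a, b) ≠ s(x, y) → a ≠ x := by
          rintro a b hab hpab hne rfl
          refine hne ?_
          congr 1
          obtain ⟨i, b, hb⟩ := b
          obtain ⟨j, y, hy⟩ := y
          obtain rfl : i = j := Fin.ext (by simp only at hab hxy; omega)
          obtain rfl : b = y := hpab.symm.trans hpar
          rfl
        rcases hadj with ⟨h1, h2⟩ | ⟨h1, h2⟩
        · exact hchild u v h1 h2 (huniq v u h1 h2 (by rwa [Sym2.eq_swap]))
        · exact (hchild v u h1 h2 (huniq u v h1 h2 hne)).symm
    intro hreach
    have hx : D x := ⟨le_rfl, by rw [Nat.sub_self]; rfl⟩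
    have := ((hinv x y hreach).1 hx).1
    omega
  intro x y hadj
  rcases hadj with ⟨h1, h2⟩ | ⟨h1, h2⟩
  · rw [Sym2.eq_swap]
    exact hbridge y x h1 h2
  · exact hbridge x y h1 h2

/-- Since `φ` intertwines the parent maps, edges are preserved; since it is injective on each level,
they are also reflected. -/
theorem exists_levelGraph_iso {α β : Type} {A : ℕ → Set α} {B : ℕ → Set β} {u : α → α} {v : β → β}
    {N : ℕ} {φ : α → β} (hφ : ∀ k ≤ N, Set.BijOn φ (A k) (B k))
    (hu : ∀ k < N, Set.MapsTo u (A (k + 1)) (A k))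
    (hc : ∀ k < N, ∀ x ∈ A (k + 1), φ (u x) = v (φ x)) :
    ∃ e : levelGraph A u N ≃g levelGraph B v N,
      ∀ x, (e x).1 = x.1 ∧ ((e x).2 : β) = φ x.2 := by
  let e : Vertex A N ≃ Vertex B N := Equiv.sigmaCongrRight fun k =>
    (hφ k (Nat.lt_succ_iff.1 k.2)).equiv φ
  have he : ∀ x, (e x).1 = x.1 ∧ ((e x).2 : β) = φ x.2 := fun x => ⟨rfl, rfl⟩
  have key : ∀ x y : Vertex A N, (x.1 : ℕ) = (y.1 : ℕ) + 1 →
      (v (φ x.2) = φ y.2 ↔ u x.2 = y.2) := by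
    rintro ⟨⟨i, hi⟩, x, hx⟩ ⟨⟨j, hj⟩, y, hy⟩ h
    obtain rfl : i = j + 1 := h
    simp only
    rw [← hc j (by omega) x hx]
    exact (hφ j (by omega)).injOn.eq_iff (hu j (by omega) hx) hy
  refine ⟨⟨e, ?_⟩, he⟩
  intro x y
  exact or_congr (and_congr_right fun h => key y x h) (and_congr_right fun h => key x y h)

end FareyTree

/-! ### The two trees and their isomorphism -/

theorem corollary1 (N : ℕ) :
    -- Both graphs are trees, whose edges come from surjections between successive levels
    -- and whose level 0 consists of the root.
    (FareyTree.fareyTree N).IsTree ∧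
    FareyTree.fareyLevel 0 = {((0, ⊤), (0, 0))} ∧
    (∀ k < N,
      Set.MapsTo FareyTree.fareyParent (FareyTree.fareyLevel (k + 1)) (FareyTree.fareyLevel k) ∧
      Set.SurjOn FareyTree.fareyParent (FareyTree.fareyLevel (k + 1)) (FareyTree.fareyLevel k)) ∧
    (FareyTree.terminalTree N).IsTree ∧
    FareyTree.terminalLevel 2 = {(1, 1, (1, 1))} ∧
    (∀ k < N,
      Set.MapsTo FareyTree.terminalParent
        (FareyTree.terminalLevel (k + 3)) (FareyTree.terminalLevel (k + 2)) ∧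
      Set.SurjOn FareyTree.terminalParent
        (FareyTree.terminalLevel (k + 3)) (FareyTree.terminalLevel (k + 2))) ∧
    -- The second tree is generated from its root by the simple recursive rule.
    (∀ k < N,
      FareyTree.terminalLevel (k + 3) =
        {w | ∃ v ∈ FareyTree.terminalLevel (k + 2), FareyTree.ChildRule v w} ∧
      ∀ v ∈ FareyTree.terminalLevel (k + 2), ∀ w,
        (w ∈ FareyTree.terminalLevel (k + 3) ∧ FareyTree.terminalParent w = v) ↔
          FareyTree.ChildRule v w) ∧
    -- Level by level, yet another Surányi's map is well defined (independent of the choice of the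
    -- parameter in the interval) and bijective onto the Young terminal pairs, which are exactly the
    -- terminal pairs of difference equation type.
    (∀ k ≤ N,
      (∀ a b m n, ((a, b), (m, n)) ∈ FareyTree.fareyLevel k →
        ∀ ξ : ℝ, a < (ξ : EReal) → (ξ : EReal) < b →
          FareyTree.suranyi ((a, b), (m, n)) = FareyTree.rankingPair m n ξ) ∧
      Set.BijOn FareyTree.suranyi (FareyTree.fareyLevel k) (FareyTree.youngLevel (k + 2)) ∧
      FareyTree.youngLevel (k + 2) = FareyTree.terminalLevel (k + 2)) ∧
    -- These bijections form an isomorphism of rooted trees.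
    ∃ e : FareyTree.fareyTree N ≃g FareyTree.terminalTree N,
      e (FareyTree.fareyRoot N) = FareyTree.terminalRoot N ∧
      ∀ x, (e x).1 = x.1 ∧ ((e x).2 : FareyTree.TaggedPair) = FareyTree.suranyi x.2 := by
  refine ⟨FareyTree.levelGraph_isTree FareyTree.fareyLevel_zero
      fun k _ => FareyTree.fareyParent_mapsTo k, FareyTree.fareyLevel_zero,
    fun k _ => ⟨FareyTree.fareyParent_mapsTo k, FareyTree.fareyParent_surjOn k⟩,
    FareyTree.levelGraph_isTree FareyTree.terminalLevel_two
      fun k _ => FareyTree.terminalParent_mapsTo k, FareyTree.terminalLevel_two,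
    fun k _ => ⟨FareyTree.terminalParent_mapsTo k, FareyTree.terminalParent_surjOn k⟩,
    fun k _ => ⟨FareyTree.terminalLevel_succ k,
      fun v hv w => FareyTree.childRule_iff (by omega) hv⟩,
    fun k _ => ⟨fun a b m n hx ξ ha hb => (FareyTree.mem_fareyLevel.1 hx).2.suranyi_eq ha hb,
      FareyTree.suranyi_bijOn k, FareyTree.youngLevel_eq_terminalLevel k⟩, ?_⟩
  obtain ⟨e, he⟩ := FareyTree.exists_levelGraph_iso (N := N) (φ := FareyTree.suranyi)
    (v := FareyTree.terminalParent)
    (fun k _ => FareyTree.suranyi_bijOn_terminalLevel k)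
    (fun k _ => FareyTree.fareyParent_mapsTo k) (fun k _ x hx => FareyTree.suranyi_fareyParent hx)
  refine ⟨e, ?_, he⟩
  -- The root needs no computation: levels are preserved and level 0 of the terminal tree is a
  -- single vertex.
  obtain ⟨h1, -⟩ := he (FareyTree.fareyRoot N)
  generalize e (FareyTree.fareyRoot N) = z at h1
  obtain ⟨i, z, hz⟩ := z
  obtain rfl : i = 0 := h1
  have hz' : z = (1, 1, (1, 1)) := by
    have hz2 : z ∈ FareyTree.terminalLevel 2 := hz
    rwa [FareyTree.terminalLevel_two] at hz2
  subst hz'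
  rfl
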